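/- A temporal Lorentzian spectral triple $(\mathcal A,\widetilde{\mathcal A},\mathcal H,D,\mathcal T)$ consists of a Hilbert space $\mathcal H$; a $*$-algebra $\mathcal A\subset B(\mathcal H)$ without unit which is an ideal of a unital $*$-algebra $\widetilde{\mathcal A}\subset B(\mathcal H)$; an unbounded self-adjoint operator $\mathcal T$ with $(1+\mathcal T^2)^{-1/2}\in\widetilde{\mathcal A}$; and a densely defined operator $D$ such that $[D,a]$ is bounded for all $a\in\widetilde{\mathcal A}$; $[D,\mathcal T]$ is self-adjoint, commutes with $\widetilde{\mathcal A}$, and $[D,\mathcal T]^2=u\in\widetilde{\mathcal A}$ with $u>0$ (positive and invertible); $[D,\mathcal T]D$ is skew-self-adjoint; and $a(1+\langle D\rangle^2)^{-1/2}$ is compact for all $a\in\mathcal A$, where $\langle D\rangle^2=-\tfrac12\big(D[D,\mathcal T]D[D,\mathcal T]+[D,\mathcal T]D[D,\mathcal T]D\big)$. Let $(M,g)$ be a smooth pseudo-Riemannian $n$-manifold of arbitrary signature with a spin structure and a spacelike reflection, and let $S$ be its spinor bundle. The Clifford action satisfies $c(\xi)^2=g^{-1}(\xi,\xi)$, and $S$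 carries the Hermitian structure for which the gamma matrices $\gamma^a=c(e^a)$ of the pseudo-orthonormal coframes $(e^a)$ adapted to the reflection are Hermitian if $g^{-1}(e^a,e^a)=1$ and anti-Hermitian if $g^{-1}(e^a,e^a)=-1$. Let $(\mathcal A,\widetilde{\mathcal A},\mathcal H,D,\mathcal T)$ be a temporal Lorentzian spectral triple with commutative algebra that comes from this spin manifold: $\mathcal H=L^2(M,S)$ with $(\psi,\phi)=\int_M\psi^*\phi\,d\mu_g$, $d\mu_g=\sqrt{|\det g|}\,d^nx$; the elements of $\mathcal A$ (resp. $\widetilde{\mathcal A}$) act by multiplication with smooth functions vanishing at infinity (resp. smooth bounded functions); $\mathcal T$ acts by multiplication with a smooth function $\mathcal T:M\to\mathbb R$; and $D$ acts on smooth compactly supported spinor fields as the Dirac operator $-i\,c\circ\nabla^S$. Then: 1. $g^{-1}(d\mathcal T,d\mathcal T)<0$ everywhere (in particular $d\mathcal T$ vanishes nowhere), and $g$ has Lorentzian signature $(-,+,\dots,+)$. 2. $c(d\mathcal T)$ is anti-Hermitian, and $c(\xi)$ is Hermitian for every covector $\xi$ with $g^{-1}(d\mathcal T,\xi)=0$.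 3. The metric splits globally and orthogonally: $g=-\beta\,d\mathcal T^2+h$ with $\beta$ a smooth positive function and $h$ a smooth symmetric $2$-tensor field that is positive definite on the tangent spaces $\ker d\mathcal T$ of the level sets of $\mathcal T$ and satisfies $h(\nabla\mathcal T,\cdot)=0$, where $\nabla\mathcal T$ is transversal to $\ker d\mathcal T$. 4. In any local coordinates with $x^0=\mathcal T$ one has $g^{00}<0$; and if at a point each gamma matrix $\gamma^\mu=c(dx^\mu)$ is either Hermitian or anti-Hermitian, then at that point $\gamma^\mu$ is Hermitian and $g^{0\mu}=0$ for all $\mu>0$. -/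

import Mathlib

open scoped Manifold ContDiff Topology InnerProductSpace

noncomputable section

/-! ### Unbounded operators and temporal Lorentzian spectral triples -/

namespace UnboundedOp

variable {H : Type*} [NormedAddCommGroup H] [InnerProductSpace ℂ H]

/-- The product `f g` of two unbounded operators, on its natural domain
`{x ∈ Dom g | g x ∈ Dom f}`. -/
def mul (f g : H →ₗ.[ℂ] H) : H →ₗ.[ℂ] H where
  domain :=
    { carrier := {x | ∃ hx : x ∈ g.domain, g ⟨x, hx⟩ ∈ f.domain}
      zero_mem' := ⟨g.domain.zero_mem, by
        have h : g ⟨0, g.domain.zero_mem⟩ = 0 := g.map_zero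
        rw [h]
        exact f.domain.zero_mem⟩
      add_mem' := by
        rintro x y ⟨hx, hx'⟩ ⟨hy, hy'⟩
        refine ⟨g.domain.add_mem hx hy, ?_⟩
        have h : g ⟨x + y, g.domain.add_mem hx hy⟩ = g ⟨x, hx⟩ + g ⟨y, hy⟩ :=
          g.map_add ⟨x, hx⟩ ⟨y, hy⟩
        rw [h]
        exact f.domain.add_mem hx' hy'
      smul_mem' := by
        rintro z x ⟨hx, hx'⟩
        refine ⟨g.domain.smul_mem z hx, ?_⟩
        have h : g ⟨z • x, g.domain.smul_mem z hx⟩ = z • g ⟨x, hx⟩ := g.map_smul z ⟨x, hx⟩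
        rw [h]
        exact f.domain.smul_mem z hx' }
  toFun :=
    { toFun := fun x => f ⟨g ⟨x.1, x.2.choose⟩, x.2.choose_spec⟩
      map_add' := by
        rintro ⟨x, hx, hx'⟩ ⟨y, hy, hy'⟩
        refine Eq.trans ?_ (f.map_add ⟨g ⟨x, hx⟩, hx'⟩ ⟨g ⟨y, hy⟩, hy'⟩)
        exact congrArg f (Subtype.ext (g.map_add ⟨x, hx⟩ ⟨y, hy⟩))
      map_smul' := by
        rintro z ⟨x, hx, hx'⟩
        refine Eq.trans ?_ (f.map_smul z ⟨g ⟨x, hx⟩, hx'⟩)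
        exact congrArg f (Subtype.ext (g.map_smul z ⟨x, hx⟩)) }

/-- A bounded operator regarded as an everywhere defined unbounded operator. -/
def ofBounded (B : H →L[ℂ] H) : H →ₗ.[ℂ] H := (B : H →ₗ[ℂ] H).toPMap ⊤

/-- The operator `1 + P`, on the domain of `P`. -/
def onePlus (P : H →ₗ.[ℂ] H) : H →ₗ.[ℂ] H := ofBounded 1 + P

/-- The closure of `P` is the everywhere defined bounded operator `B`. -/
def ClosureIsBounded (P : H →ₗ.[ℂ] H) (B : H →L[ℂ] H) : Prop :=
  ∀ x y : H, (x, y) ∈ P.graph.topologicalClosure ↔ y = B x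

/-- `R = P^{-1/2}` for a (possibly only essentially closed) unbounded operator `P`:
the bounded operator `R²` is the inverse of the closure of `P`, and `R` is the principal square
root of `R²`, that is, its spectrum lies in the closed right half plane.
For a positive self-adjoint `P` this is the usual positive operator `P^{-1/2}`. -/
def IsInvSqrt (P : H →ₗ.[ℂ] H) (R : H →L[ℂ] H) : Prop :=
  (∀ x y : H, (x, y) ∈ P.graph.topologicalClosure ↔ x = R (R y)) ∧
    ∀ z ∈ spectrum ℂ R, 0 ≤ z.re

end UnboundedOp

open UnboundedOp in
/-- A temporal Lorentzian spectral triple `(A, Ã, H, D, T)` on the Hilbert space `H`.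
The pre-`C⋆`-algebras are identified with their images under the faithful representation on `H`. -/
structure TemporalLorentzianSpectralTriple (H : Type*) [NormedAddCommGroup H]
    [InnerProductSpace ℂ H] [CompleteSpace H] where
  /-- the algebra `A` -/
  alg : NonUnitalStarSubalgebra ℂ (H →L[ℂ] H)
  /-- the preferred unitization `Ã` of `A` -/
  algTilde : StarSubalgebra ℂ (H →L[ℂ] H)
  /-- `A` has no unit -/
  nonunital : ¬ ∃ e ∈ alg, ∀ a ∈ alg, e * a = a ∧ a * e = a
  alg_le : ∀ a ∈ alg, a ∈ algTilde
  /-- `A` is an ideal of `Ã` -/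
  ideal : ∀ a ∈ alg, ∀ b ∈ algTilde, a * b ∈ alg ∧ b * a ∈ alg
  /-- the time operator `T` -/
  T : H →ₗ.[ℂ] H
  T_selfAdjoint : IsSelfAdjoint T
  /-- `(1 + T²)^{-1/2} ∈ Ã` -/
  T_inv_mem : ∃ R ∈ algTilde, IsInvSqrt (onePlus (mul T T)) R
  /-- the Dirac operator `D` -/
  D : H →ₗ.[ℂ] H
  D_dense : Dense (D.domain : Set H)
  /-- for `a ∈ Ã` the commutator `[D, a]` is defined on `Dom D` and bounded -/
  commutator_bounded : ∀ a ∈ algTilde, ∃ B : H →L[ℂ] H, ∀ x : D.domain,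
    ∃ hx : a x ∈ D.domain, D ⟨a x, hx⟩ - a (D x) = B x
  /-- the operator `[D, T]`; it is bounded, its square being an element of `Ã` -/
  commDT : H →L[ℂ] H
  commDT_eq : ClosureIsBounded (mul D T - mul T D) commDT
  commDT_selfAdjoint : IsSelfAdjoint commDT
  commDT_commute : ∀ a ∈ algTilde, commDT * a = a * commDT
  /-- `u = [D, T]² ∈ Ã` -/
  commDT_sq_mem : commDT * commDT ∈ algTilde
  /-- `u > 0`, i.e. `u` is positive and invertible -/
  commDT_sq_pos : IsStrictlyPositive (commDT * commDT)
  /-- `[D, T] D` is skew-self-adjoint -/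
  skewAdjoint : (mul (ofBounded commDT) D).adjoint = -(mul (ofBounded commDT) D)
  /-- `a (1 + ⟨D⟩²)^{-1/2}` is compact for `a ∈ A`, where
  `⟨D⟩² = -½ (D [D,T] D [D,T] + [D,T] D [D,T] D)` -/
  compact : ∃ R : H →L[ℂ] H,
    IsInvSqrt (onePlus ((-(1 / 2 : ℂ)) •
      (mul (mul D (ofBounded commDT)) (mul D (ofBounded commDT)) +
        mul (mul (ofBounded commDT) D) (mul (ofBounded commDT) D)))) R ∧
    ∀ a ∈ alg, IsCompactOperator (a * R)

/-- The algebra of the triple is commutative. -/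
def TemporalLorentzianSpectralTriple.IsCommutative {H : Type*} [NormedAddCommGroup H]
    [InnerProductSpace ℂ H] [CompleteSpace H] (X : TemporalLorentzianSpectralTriple H) : Prop :=
  ∀ a ∈ X.algTilde, ∀ b ∈ X.algTilde, a * b = b * a

/-! ### Pseudo-Riemannian metrics -/

section Geometry

variable {n : ℕ} {M : Type*} [TopologicalSpace M] [ChartedSpace (EuclideanSpace ℝ (Fin n)) M]

/-- The differential `df` of a real function, as a field of covectors. -/
def differential (f : M → ℝ) (x : M) : TangentSpace (𝓡 n) x →L[ℝ] ℝ :=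
  mfderiv (𝓡 n) 𝓘(ℝ, ℝ) f x

/-- The coordinate function `x^μ` of a chart. -/
def coordFun (e : OpenPartialHomeomorph M (EuclideanSpace ℝ (Fin n))) (μ : Fin n) : M → ℝ :=
  fun y => e y μ

/-- The coordinate vector `∂_μ` of a chart, at the point with coordinates `y`. -/
def coordVec (e : OpenPartialHomeomorph M (EuclideanSpace ℝ (Fin n))) (μ : Fin n)
    (y : EuclideanSpace ℝ (Fin n)) : TangentSpace (𝓡 n) (e.symm y) :=
  mfderiv (𝓡 n) (𝓡 n) e.symm y (EuclideanSpace.single μ (1 : ℝ))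

variable [IsManifold (𝓡 n) ∞ M]

/-- A field of bilinear forms on the tangent spaces is a smooth covariant 2-tensor field. -/
def IsSmoothTwoTensor
    (h : (x : M) → TangentSpace (𝓡 n) x →L[ℝ] TangentSpace (𝓡 n) x →L[ℝ] ℝ) : Prop :=
  ContMDiff (𝓡 n)
    ((𝓡 n).prod 𝓘(ℝ, EuclideanSpace ℝ (Fin n) →L[ℝ] EuclideanSpace ℝ (Fin n) →L[ℝ] ℝ)) ∞
    (fun x => Bundle.TotalSpace.mk' (EuclideanSpace ℝ (Fin n) →L[ℝ] EuclideanSpace ℝ (Fin n) →L[ℝ] ℝ)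
      (E := fun x : M => TangentSpace (𝓡 n) x →L[ℝ] TangentSpace (𝓡 n) x →L[ℝ] ℝ) x (h x))

variable (n M) in
/-- A smooth pseudo-Riemannian metric (of arbitrary signature) on the `n`-manifold `M`. -/
structure PseudoRiemannianMetric where
  /-- the bilinear form `g_x` -/
  val : (x : M) → TangentSpace (𝓡 n) x →L[ℝ] TangentSpace (𝓡 n) x →L[ℝ] ℝ
  symm : ∀ x v w, val x v w = val x w v
  nondegenerate : ∀ x v, (∀ w, val x v w = 0) → v = 0
  smooth : IsSmoothTwoTensor val

namespace PseudoRiemannianMetric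

variable (g : PseudoRiemannianMetric n M)

lemma flat_injective (x : M) : Function.Injective
    ((ContinuousLinearMap.coeLM ℝ : (TangentSpace (𝓡 n) x →L[ℝ] ℝ) →ₗ[ℝ] _).comp
      (g.val x : TangentSpace (𝓡 n) x →ₗ[ℝ] (TangentSpace (𝓡 n) x →L[ℝ] ℝ))) := by
  rw [← LinearMap.ker_eq_bot, LinearMap.ker_eq_bot']
  intro v hv
  exact g.nondegenerate x v fun w => LinearMap.congr_fun hv w

lemma exists_sharp (x : M) (ξ : TangentSpace (𝓡 n) x →L[ℝ] ℝ) :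
    ∃ v : TangentSpace (𝓡 n) x, ∀ w, g.val x v w = ξ w := by
  have : FiniteDimensional ℝ (TangentSpace (𝓡 n) x) :=
    inferInstanceAs (FiniteDimensional ℝ (EuclideanSpace ℝ (Fin n)))
  have hs := (LinearMap.injective_iff_surjective_of_finrank_eq_finrank
    (Subspace.dual_finrank_eq (K := ℝ) (V := TangentSpace (𝓡 n) x)).symm).1 (g.flat_injective x)
  obtain ⟨v, hv⟩ := hs (ξ : TangentSpace (𝓡 n) x →ₗ[ℝ] ℝ)
  exact ⟨v, fun w => LinearMap.congr_fun hv w⟩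

/-- The vector `ξ^♯` with `g(ξ^♯, w) = ξ(w)` for all `w`. -/
def sharp (x : M) (ξ : TangentSpace (𝓡 n) x →L[ℝ] ℝ) : TangentSpace (𝓡 n) x :=
  (g.exists_sharp x ξ).choose

lemma sharp_spec (x : M) (ξ : TangentSpace (𝓡 n) x →L[ℝ] ℝ) (w : TangentSpace (𝓡 n) x) :
    g.val x (g.sharp x ξ) w = ξ w :=
  (g.exists_sharp x ξ).choose_spec w

/-- The inverse metric on covectors; `g^{μν} = cometric (dx^μ) (dx^ν)`. -/
def cometric (x : M) (ξ ζ : TangentSpace (𝓡 n) x →L[ℝ] ℝ) : ℝ :=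
  ξ (g.sharp x ζ)

/-- `g` has Lorentzian signature `(-, +, …, +)` at every point: some vector is timelike, and `g` is
positive definite on its orthogonal complement. -/
def IsLorentzian : Prop :=
  ∀ x : M, ∃ v : TangentSpace (𝓡 n) x, g.val x v v < 0 ∧
    ∀ w : TangentSpace (𝓡 n) x, g.val x v w = 0 → w ≠ 0 → 0 < g.val x w w

/-- The global orthogonal splitting `g = -β dτ² + h` along the function `τ`: `β` is a smooth
positive function and `h` is a smooth symmetric tensor field which restricts to a Riemannian metric
on the level sets of `τ` (whose tangent spaces are the kernels of `dτ`) and vanishes on the gradient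
of `τ`, which is transversal to the level sets. -/
def SplitsAlong (τ : M → ℝ) : Prop :=
  ∃ (β : M → ℝ) (h : (x : M) → TangentSpace (𝓡 n) x →L[ℝ] TangentSpace (𝓡 n) x →L[ℝ] ℝ),
    ContMDiff (𝓡 n) 𝓘(ℝ, ℝ) ∞ β ∧ (∀ x, 0 < β x) ∧
    IsSmoothTwoTensor h ∧ (∀ x v w, h x v w = h x w v) ∧
    ∀ x,
      (∀ v w, g.val x v w = -(β x) * (differential τ x v * differential τ x w) + h x v w) ∧
      (∀ v, differential τ x v = 0 → v ≠ 0 → 0 < h x v v) ∧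
      (∀ w, h x (g.sharp x (differential τ x)) w = 0) ∧
      differential τ x (g.sharp x (differential τ x)) ≠ 0

/-- `det (g_{μν})` in a chart, at the point with coordinates `y`. -/
def coordDet (e : OpenPartialHomeomorph M (EuclideanSpace ℝ (Fin n)))
    (y : EuclideanSpace ℝ (Fin n)) : ℝ :=
  Matrix.det (Matrix.of fun μ ν => g.val (e.symm y) (coordVec e μ y) (coordVec e ν y))

/-- `m` is the pseudo-Riemannian density `dμ_g`: in every smooth chart it is
`√|det g| dx¹ ⋯ dxⁿ`. -/
def IsVolume [MeasurableSpace M] (m : MeasureTheory.Measure M) : Prop :=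
  ∀ e ∈ IsManifold.maximalAtlas (𝓡 n) ∞ M, ∀ s ⊆ e.source, MeasurableSet s →
    m s = ∫⁻ y in e '' s, ENNReal.ofReal (√|g.coordDet e y|)

end PseudoRiemannianMetric

/-! ### Spin structures, spinor fields and the Dirac operator -/

/-- The complex spinor module of dimension `2^⌊n/2⌋`, with its standard Hermitian product. -/
abbrev SpinorSpace (n : ℕ) := EuclideanSpace ℂ (Fin (2 ^ (n / 2)))

/-- Flat gamma matrices in dimension `n` with signs `η`: they satisfy the Clifford relations
`γ^a γ^b + γ^b γ^a = 2 η^{ab}`, and each is Hermitian or anti-Hermitian according to its sign. -/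
structure GammaMatrices (n : ℕ) where
  η : Fin n → ℝ
  η_sign : ∀ a, η a = 1 ∨ η a = -1
  γ : Fin n → SpinorSpace n →L[ℂ] SpinorSpace n
  clifford : ∀ a b, γ a * γ b + γ b * γ a = if a = b then ((2 * η a : ℝ) : ℂ) • 1 else 0
  adjoint : ∀ a, star (γ a) = ((η a : ℝ) : ℂ) • γ a

namespace GammaMatrices

variable (G : GammaMatrices n)

/-- Clifford multiplication by the vector with components `v a`. -/
def cliff (v : Fin n → ℝ) : SpinorSpace n →L[ℂ] SpinorSpace n :=
  ∑ a, ((v a : ℝ) : ℂ) • G.γ a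

/-- Unit vectors of `ℝ^{p,q}` that are purely spacelike or purely timelike. -/
def IsUnitVector (v : Fin n → ℝ) : Prop :=
  (∑ a, v a ^ 2 = 1) ∧ ((∀ a, v a ≠ 0 → G.η a = 1) ∨ (∀ a, v a ≠ 0 → G.η a = -1))

/-- The subgroup of `Spin(p,q)` lying over `S(O(p) × O(q))`, acting on spinors: all products of an
even number of purely spacelike or purely timelike unit vectors. (It is the structure group left
after a reduction of a `Spin(p,q)`-structure by a spacelike reflection, and it acts unitarily.) -/
def spinGroup : Submonoid (SpinorSpace n →L[ℂ] SpinorSpace n) :=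
  Submonoid.closure {s | ∃ v w, G.IsUnitVector v ∧ G.IsUnitVector w ∧ s = G.cliff v * G.cliff w}

end GammaMatrices

/-- A spin structure on `(M, g)`, together with a spacelike reflection, presented by local
trivialisations: open sets `U i` covering `M`, smooth pseudo-orthonormal frames `E i` over them,
adapted to the reflection (which changes the sign of the frame vectors of negative square), and
`Spin`-valued transition functions satisfying the cocycle condition and lifting the transition
functions of the frames. -/
structure SpinStructure (g : PseudoRiemannianMetric n M) where
  gam : GammaMatrices n
  ι : Type*
  U : ι → Set M
  isOpen_U : ∀ i, IsOpen (U i)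
  cover : ∀ x, ∃ i, x ∈ U i
  /-- the frame vector fields `E_a` over `U i` -/
  E : ι → Fin n → (x : M) → TangentSpace (𝓡 n) x
  E_smooth : ∀ i a, ContMDiffOn (𝓡 n) (𝓡 n).tangent ∞
    (fun x => (⟨x, E i a x⟩ : TangentBundle (𝓡 n) M)) (U i)
  E_orthonormal : ∀ i, ∀ x ∈ U i, ∀ a b,
    g.val x (E i a x) (E i b x) = if a = b then gam.η a else 0
  /-- the transition functions -/
  lam : ι → ι → M → (SpinorSpace n →L[ℂ] SpinorSpace n)
  lam_smooth : ∀ i j, ContMDiffOn (𝓡 n) 𝓘(ℝ, SpinorSpace n →L[ℂ] SpinorSpace n) ∞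
    (lam i j) (U i ∩ U j)
  lam_mem : ∀ i j, ∀ x ∈ U i ∩ U j, lam i j x ∈ gam.spinGroup
  lam_cocycle : ∀ i j k, ∀ x ∈ U i ∩ U j ∩ U k, lam i j x * lam j k x = lam i k x
  lam_lifts : ∀ i j, ∀ x ∈ U i ∩ U j, ∀ ξ : TangentSpace (𝓡 n) x →L[ℝ] ℝ,
    gam.cliff (fun a => ξ (E i a x)) * lam i j x = lam i j x * gam.cliff (fun a => ξ (E j a x))

namespace SpinStructure

variable {g : PseudoRiemannianMetric n M} (S : SpinStructure g)

/-- The Clifford action `c(ξ) = ∑ ξ(E_a) γ^a` of a covector on spinors, in the trivialisation `i`;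
it satisfies `c(ξ)² = g^{-1}(ξ, ξ)`. -/
def c (i : S.ι) (x : M) (ξ : TangentSpace (𝓡 n) x →L[ℝ] ℝ) :
    SpinorSpace n →L[ℂ] SpinorSpace n :=
  S.gam.cliff fun a => ξ (S.E i a x)

/-- Smooth compactly supported sections of the spinor bundle, given by the families `ψ i` of their
components in the trivialisations (extended by zero outside `U i`). -/
def testSpinors : Submodule ℂ (S.ι → M → SpinorSpace n) where
  carrier := {ψ | (∀ i, ∀ x ∉ S.U i, ψ i x = 0) ∧
    (∀ i j, ∀ x ∈ S.U i ∩ S.U j, ψ i x = S.lam i j x (ψ j x)) ∧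
    (∀ i, ContMDiffOn (𝓡 n) 𝓘(ℝ, SpinorSpace n) ∞ (ψ i) (S.U i)) ∧
    ∃ K : Set M, IsCompact K ∧ ∀ i, ∀ x ∉ K, ψ i x = 0}
  zero_mem' := ⟨fun _ _ _ => rfl, fun _ _ _ _ => by simp, fun _ => contMDiffOn_const,
    ∅, isCompact_empty, fun _ _ _ => rfl⟩
  add_mem' := by
    rintro ψ φ ⟨h1, h2, h3, K, hK, h4⟩ ⟨k1, k2, k3, L, hL, k4⟩
    refine ⟨fun i x hx => ?_, fun i j x hx => ?_, fun i => (h3 i).add (k3 i),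
      K ∪ L, hK.union hL, fun i x hx => ?_⟩
    · simp [h1 i x hx, k1 i x hx]
    · simp only [Pi.add_apply, map_add]
      rw [h2 i j x hx, k2 i j x hx]
    · rw [Set.mem_union, not_or] at hx
      simp [h4 i x hx.1, k4 i x hx.2]
  smul_mem' := by
    rintro z ψ ⟨h1, h2, h3, K, hK, h4⟩
    refine ⟨fun i x hx => ?_, fun i j x hx => ?_, fun i => ?_, K, hK, fun i x hx => ?_⟩
    · simp [h1 i x hx]
    · simp only [Pi.smul_apply, map_smul]
      rw [h2 i j x hx]
    · exact (contDiff_const_smul z).contMDiff.comp_contMDiffOn (h3 i)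
    · simp [h4 i x hx]

/-- The product of a spinor field with a smooth complex function. -/
def mulSpinor (f : M → ℂ) (hf : ContMDiff (𝓡 n) 𝓘(ℝ, ℂ) ∞ f) (ψ : S.testSpinors) :
    S.testSpinors :=
  ⟨fun i x => f x • ψ.1 i x, by
    obtain ⟨ψ, h1, h2, h3, K, hK, h4⟩ := ψ
    refine ⟨fun i x hx => ?_, fun i j x hx => ?_, fun i => ?_, K, hK, fun i x hx => ?_⟩
    · simp [h1 i x hx]
    · simp only [map_smul]
      rw [h2 i j x hx]
    · have hsm : ContDiff ℝ ∞ fun p : ℂ × SpinorSpace n => p.1 • p.2 :=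
        contDiff_fst.smul contDiff_snd
      exact hsm.contMDiff.comp_contMDiffOn (hf.contMDiffOn.prodMk_space (h3 i))
    · simp [h4 i x hx]⟩

/-- The pointwise Hermitian product `ψ^*φ` of two spinor fields, which does not depend on the
trivialisation used to compute it. -/
def pointwiseInner (ψ φ : S.ι → M → SpinorSpace n) (x : M) : ℂ :=
  ⟪ψ (S.cover x).choose x, φ (S.cover x).choose x⟫_ℂ

/-- The Levi-Civita connection coefficients `ω_{bc}(E_a) = g(E_b, ∇_{E_a} E_c)` of the frame `i`,
by the Koszul formula for a pseudo-orthonormal frame. -/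
def omega (i : S.ι) (a b c : Fin n) (x : M) : ℝ :=
  (1 / 2) * (g.val x (VectorField.mlieBracket (𝓡 n) (S.E i a) (S.E i c) x) (S.E i b x)
    - g.val x (VectorField.mlieBracket (𝓡 n) (S.E i a) (S.E i b) x) (S.E i c x)
    - g.val x (VectorField.mlieBracket (𝓡 n) (S.E i c) (S.E i b) x) (S.E i a x))

/-- The derivative of a spinor-valued function along a tangent vector. -/
def spinorDeriv (ψ : M → SpinorSpace n) (x : M) (v : TangentSpace (𝓡 n) x) : SpinorSpace n :=
  mfderiv (𝓡 n) 𝓘(ℝ, SpinorSpace n) ψ x v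

/-- The spin connection `∇^S_{E_a} ψ = E_a ψ + ¼ ∑ ω_{bc}(E_a) γ^b γ^c ψ` in the trivialisation
`i`. -/
def nabla (i : S.ι) (a : Fin n) (ψ : M → SpinorSpace n) (x : M) : SpinorSpace n :=
  spinorDeriv ψ x (S.E i a x)
    + (1 / 4 : ℂ) • ∑ b, ∑ c, ((S.omega i a b c x : ℝ) : ℂ) • S.gam.γ b (S.gam.γ c (ψ x))

/-- `χ = D ψ`, where `D = -i (c ∘ ∇^S) = -i ∑ γ^a ∇^S_{E_a}` is the Dirac operator. -/
def IsDirac (ψ χ : S.ι → M → SpinorSpace n) : Prop :=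
  ∀ i, ∀ x ∈ S.U i, χ i x = (-Complex.I) • ∑ a, S.gam.γ a (S.nabla i a (ψ i) x)

end SpinStructure

/-! ### Triples that come from a pseudo-Riemannian spin manifold -/

/-- The spectral triple `X` comes from the pseudo-Riemannian spin manifold `(M, g)` with spin
structure `S` and time function `time`: `H = L²(M, S)`, the algebras act by multiplication with
smooth functions (vanishing at infinity, resp. bounded), `T` acts as multiplication by the real
smooth function `time`, and `D` as the Dirac operator. -/
structure ComesFromSpinManifold {H : Type*} [NormedAddCommGroup H] [InnerProductSpace ℂ H]
    [CompleteSpace H] [MeasurableSpace M] {g : PseudoRiemannianMetric n M}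
    (X : TemporalLorentzianSpectralTriple H) (S : SpinStructure g) (time : M → ℝ) where
  /-- the pseudo-Riemannian density `dμ_g` -/
  vol : MeasureTheory.Measure M
  isVolume : g.IsVolume vol
  /-- `H` is the space of square integrable spinor fields, that is, the completion of the space of
  smooth compactly supported ones for `(ψ, φ) = ∫ ψ^*φ dμ_g`: `toH` is the canonical map. -/
  toH : S.testSpinors →ₗ[ℂ] H
  dense_toH : DenseRange toH
  inner_toH : ∀ ψ φ : S.testSpinors, ⟪toH ψ, toH φ⟫_ℂ = ∫ x, S.pointwiseInner ψ.1 φ.1 x ∂vol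
  /-- `Ã` acts by multiplication with smooth bounded functions -/
  algTilde_mul : ∀ a ∈ X.algTilde, ∃ (f : M → ℂ) (hf : ContMDiff (𝓡 n) 𝓘(ℝ, ℂ) ∞ f),
    (∃ C : ℝ, ∀ x, ‖f x‖ ≤ C) ∧ ∀ ψ, a (toH ψ) = toH (S.mulSpinor f hf ψ)
  /-- `A` acts by multiplication with smooth functions vanishing at infinity -/
  alg_mul : ∀ a ∈ X.alg, ∃ (f : M → ℂ) (hf : ContMDiff (𝓡 n) 𝓘(ℝ, ℂ) ∞ f),
    Filter.Tendsto f (Filter.cocompact M) (𝓝 0) ∧ ∀ ψ, a (toH ψ) = toH (S.mulSpinor f hf ψ)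
  time_smooth : ContMDiff (𝓡 n) 𝓘(ℝ, ℂ) ∞ fun x => (time x : ℂ)
  /-- `T` acts by multiplication with `time` (being self-adjoint, it is then the closure of this
  multiplication operator on smooth compactly supported spinor fields) -/
  T_mul : ∀ ψ, (toH ψ, toH (S.mulSpinor (fun x => (time x : ℂ)) time_smooth ψ)) ∈ X.T.graph
  /-- `D` acts on smooth compactly supported spinor fields as the Dirac operator, i.e. it is
  a closed extension of the Dirac operator on that initial domain -/
  D_dirac : ∀ ψ : S.testSpinors, ∃ χ : S.testSpinors,
    S.IsDirac ψ.1 χ.1 ∧ (toH ψ, toH χ) ∈ X.D.graph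

end Geometry

end

/-!
Operators of order zero on spinor fields are determined pointwise: a symmetry or positivity property
that such an operator has in `L²(M, S)` holds for its symbol at each point. Here
`[D, T] = -i c(dT)`, while `[[D, T] D, f] = -c(dT) c(df)`. Hence self-adjointness and invertibility
of `[D, T]` say that `c(dT)` is anti-Hermitian and that `c(dT)² = g⁻¹(dT, dT)` is negative, and
skewness of `[D, T] D` says that `c(dT) c(ξ)` is Hermitian for every covector `ξ`.

The rest is Clifford algebra at a point: `c(ξ)` is Hermitian if and only if it anticommutes with
`c(dT)`, that is, if and only if `ξ` is orthogonal to `dT`, and then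
`g⁻¹(ξ, ξ) = c(ξ)^* c(ξ) > 0` for `ξ ≠ 0`. Conversely, if `c(ξ)` is anti-Hermitian, then it commutes
with `c(dT)`, so that `ξ` is a multiple of `dT`.
-/

open MeasureTheory

section CliffordMap

variable {V A : Type*} [AddCommGroup V] [Module ℝ V] [Ring A] [Algebra ℝ A]

/-- The linear map `c` satisfies the Clifford relations of the bilinear form `B`, normalised so that
`c v * c v = B v v`; it is then the restriction to `V` of a representation of the Clifford algebra
of `B`. -/
def IsCliffordMap (B : LinearMap.BilinForm ℝ V) (c : V →ₗ[ℝ] A) : Prop :=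
  ∀ v w, c v * c w + c w * c v = algebraMap ℝ A (2 * B v w)

/-- The conditions that the operators of a temporal spectral triple impose on the differential `τ`
of the time function at a point: `τ` is timelike for `B`, `c τ` is skew-adjoint, and `c τ * c v` is
self-adjoint for all `v`. -/
structure IsTemporal [Star A] (B : LinearMap.BilinForm ℝ V) (c : V →ₗ[ℝ] A) (τ : V) : Prop where
  neg : B τ τ < 0
  star_eq : star (c τ) = -c τ
  isSelfAdjoint_mul : ∀ v, IsSelfAdjoint (c τ * c v)

namespace IsCliffordMap

variable {B : LinearMap.BilinForm ℝ V} {c : V →ₗ[ℝ] A}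

lemma mul_eq_of_commute (hc : IsCliffordMap B c) {v w : V} (h : Commute (c v) (c w)) :
    c v * c w = algebraMap ℝ A (B v w) := by
  refine smul_right_injective A (two_ne_zero (α := ℝ)) ?_
  simpa only [h.eq, two_smul, two_mul, map_add] using hc v w

lemma mul_self (hc : IsCliffordMap B c) (v : V) : c v * c v = algebraMap ℝ A (B v v) :=
  hc.mul_eq_of_commute (Commute.refl _)

lemma isUnit_of_ne_zero (hc : IsCliffordMap B c) {v : V} (hv : B v v ≠ 0) : IsUnit (c v) := by
  rw [← isUnit_mul_self_iff, hc.mul_self]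
  exact (IsUnit.mk0 _ hv).map _

lemma injective [Nontrivial A] (hc : IsCliffordMap B c) (hB : B.SeparatingLeft) :
    Function.Injective c := by
  rw [← LinearMap.ker_eq_bot, LinearMap.ker_eq_bot']
  refine fun v hv => hB v fun w => ?_
  have h := hc v w
  rw [hv, zero_mul, mul_zero, add_zero, eq_comm, map_eq_zero_iff _ (algebraMap ℝ A).injective] at h
  exact (mul_eq_zero.1 h).resolve_left two_ne_zero

end IsCliffordMap

lemma nonneg_of_star_mul_self_eq_algebraMap {A : Type*} [CStarAlgebra A] [Nontrivial A] {y : A}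
    {r : ℝ} (h : star y * y = algebraMap ℝ A r) : 0 ≤ r :=
  spectrum_star_mul_self_nonneg r (by rw [h, spectrum.scalar_eq]; rfl)

namespace IsTemporal

section StarRing

variable [StarRing A] {B : LinearMap.BilinForm ℝ V} {c : V →ₗ[ℝ] A} {τ v : V}

lemma star_mul_eq (h : IsTemporal B c τ) (v : V) : star (c v) * c τ = -(c τ * c v) := by
  rw [← (h.isSelfAdjoint_mul v).star_eq, star_mul, h.star_eq, mul_neg, neg_neg]

variable [Nontrivial A]

lemma isSelfAdjoint_iff (h : IsTemporal B c τ) (hc : IsCliffordMap B c) :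
    IsSelfAdjoint (c v) ↔ B τ v = 0 := by
  rw [_root_.isSelfAdjoint_iff, ← (hc.isUnit_of_ne_zero h.neg.ne).mul_left_inj, h.star_mul_eq,
    neg_eq_iff_add_eq_zero, hc, map_eq_zero_iff _ (algebraMap ℝ A).injective]
  simp

lemma mem_span_of_star_eq_neg (h : IsTemporal B c τ) (hc : IsCliffordMap B c)
    (hB : B.SeparatingLeft) (hv : star (c v) = -c v) : v ∈ Submodule.span ℝ {τ} := by
  have comm : Commute (c τ) (c v) := by
    rw [Commute, SemiconjBy, ← neg_inj, ← h.star_mul_eq, hv, neg_mul]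
  have smul_eq : B τ τ • v = B τ v • τ := hc.injective hB <| by
    rw [map_smul, map_smul, Algebra.smul_def, Algebra.smul_def, ← hc.mul_self, mul_assoc,
      hc.mul_eq_of_commute comm, Algebra.commutes]
  rw [← (Submodule.span ℝ {τ}).smul_mem_iff h.neg.ne, smul_eq]
  exact Submodule.smul_mem _ _ (Submodule.mem_span_singleton_self τ)

end StarRing

lemma pos_of_orthogonal {A : Type*} [CStarAlgebra A] [Nontrivial A]
    {B : LinearMap.BilinForm ℝ V} {c : V →ₗ[ℝ] A} {τ v : V} (h : IsTemporal B c τ)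
    (hc : IsCliffordMap B c) (hB : B.SeparatingLeft) (hv : B τ v = 0) (hv0 : v ≠ 0) :
    0 < B v v := by
  have sq_eq : star (c v) * c v = algebraMap ℝ A (B v v) := by
    rw [((h.isSelfAdjoint_iff hc).2 hv).star_eq, hc.mul_self]
  refine (nonneg_of_star_mul_self_eq_algebraMap sq_eq).lt_of_ne' fun h0 => hv0 ?_
  rw [h0, map_zero, CStarRing.star_mul_self_eq_zero_iff] at sq_eq
  exact hc.injective hB (sq_eq.trans (map_zero c).symm)

end IsTemporal

end CliffordMap

lemma IsCliffordMap.mem_unitary {V A : Type*} [AddCommGroup V] [Module ℝ V] [Ring A] [StarRing A]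
    [Algebra ℝ A] {B : LinearMap.BilinForm ℝ V} {c : V →ₗ[ℝ] A} {v : V} (hc : IsCliffordMap B c)
    (hstar : star (c v) = B v v • c v) (hv : B v v * B v v = 1) : c v ∈ unitary A := by
  rw [Unitary.mem_iff, hstar, smul_mul_assoc, mul_smul_comm, hc.mul_self, Algebra.smul_def,
    ← map_mul, hv, map_one]
  exact ⟨rfl, rfl⟩

section LinearCombination

variable {ι V A : Type*} [AddCommGroup V] [Module ℝ V] [Ring A] [Algebra ℝ A]

lemma IsCliffordMap.of_basis {B : LinearMap.BilinForm ℝ V} {c : V →ₗ[ℝ] A}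
    (b : Module.Basis ι ℝ V)
    (h : ∀ i j, c (b i) * c (b j) + c (b j) * c (b i) = algebraMap ℝ A (2 * B (b i) (b j))) :
    IsCliffordMap B c := by
  have anticomm_eq : (LinearMap.mul ℝ A).compl₁₂ c c + (LinearMap.mul ℝ A).flip.compl₁₂ c c =
      ((2 : ℝ) • B).compr₂ (Algebra.linearMap ℝ A) :=
    LinearMap.ext_basis b b h
  exact fun v w => LinearMap.congr_fun₂ anticomm_eq v w

variable [Fintype ι] {γ : ι → A} {η : ι → ℝ}

lemma isCliffordMap_linearCombination [DecidableEq ι]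
    (h : ∀ a b, γ a * γ b + γ b * γ a = if a = b then algebraMap ℝ A (2 * η a) else 0) :
    IsCliffordMap (Matrix.toBilin' (Matrix.diagonal η)) (Fintype.linearCombination ℝ γ) := by
  refine .of_basis (Pi.basisFun ℝ ι) fun a b => ?_
  simp only [Pi.basisFun_apply, Fintype.linearCombination_apply_single, one_smul, h,
    Matrix.toBilin'_single, Matrix.diagonal_apply]
  split_ifs <;> simp

lemma star_linearCombination [StarRing A] [StarModule ℝ A] (h : ∀ a, star (γ a) = η a • γ a)
    (v : ι → ℝ) :
    star (Fintype.linearCombination ℝ γ v) = Fintype.linearCombination ℝ γ (η * v) := by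
  simp only [Fintype.linearCombination_apply, star_sum, star_smul, h, smul_smul, Pi.mul_apply,
    mul_comm, star_trivial]

end LinearCombination

instance nonempty_fin_two_pow {k : ℕ} : Nonempty (Fin (2 ^ k)) := ⟨⟨0, by positivity⟩⟩

namespace GammaMatrices

open scoped Matrix

variable {n : ℕ} (G : GammaMatrices n)

/-- Clifford multiplication `GammaMatrices.cliff`, bundled as a real linear map. -/
noncomputable def cliffMap : (Fin n → ℝ) →ₗ[ℝ] (SpinorSpace n →L[ℂ] SpinorSpace n) :=
  Fintype.linearCombination ℝ G.γ

lemma isCliffordMap_cliffMap :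
    IsCliffordMap (Matrix.toBilin' (Matrix.diagonal G.η)) G.cliffMap :=
  isCliffordMap_linearCombination fun a b => by
    rw [G.clifford]
    rfl

lemma star_cliff (v : Fin n → ℝ) : star (G.cliff v) = G.cliff (G.η * v) :=
  star_linearCombination G.adjoint v

lemma η_mul_self (a : Fin n) : G.η a * G.η a = 1 := by
  rcases G.η_sign a with h | h <;> simp [h]

variable {G}

lemma IsUnitVector.exists_eq_smul {v : Fin n → ℝ} (hv : G.IsUnitVector v) :
    ∃ r : ℝ, r * r = 1 ∧ G.η * v = r • v ∧
      Matrix.toBilin' (Matrix.diagonal G.η) v v = r := by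
  obtain ⟨r, hr, h⟩ : ∃ r : ℝ, r * r = 1 ∧ ∀ a, v a ≠ 0 → G.η a = r :=
    hv.2.elim (fun h => ⟨1, by norm_num, h⟩) fun h => ⟨-1, by norm_num, h⟩
  have η_mul : G.η * v = r • v := by
    ext a
    by_cases ha : v a = 0
    · simp [ha]
    · simp [h a ha]
  refine ⟨r, hr, η_mul, ?_⟩
  have diagonal_mulVec : Matrix.diagonal G.η *ᵥ v = r • v := by
    rw [← η_mul]
    exact funext fun a => Matrix.mulVec_diagonal _ _ a
  rw [Matrix.toBilin'_apply', diagonal_mulVec, dotProduct_smul]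
  simp only [dotProduct, ← sq, hv.1, smul_eq_mul, mul_one]

lemma IsUnitVector.cliff_mem_unitary {v : Fin n → ℝ} (hv : G.IsUnitVector v) :
    G.cliff v ∈ unitary (SpinorSpace n →L[ℂ] SpinorSpace n) := by
  obtain ⟨r, hr, η_mul, toBilin_eq⟩ := hv.exists_eq_smul
  refine G.isCliffordMap_cliffMap.mem_unitary (v := v) ?_ (by rw [toBilin_eq, hr])
  rw [toBilin_eq, ← map_smul, ← η_mul]
  exact G.star_cliff v

lemma spinGroup_le_unitary :
    G.spinGroup ≤ unitary (SpinorSpace n →L[ℂ] SpinorSpace n) := by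
  refine Submonoid.closure_le.2 ?_
  rintro _ ⟨v, w, hv, hw, rfl⟩
  exact mul_mem hv.cliff_mem_unitary hw.cliff_mem_unitary

end GammaMatrices

section Pointwise

variable {n : ℕ} {M : Type*} [TopologicalSpace M] [ChartedSpace (EuclideanSpace ℝ (Fin n)) M]
  [IsManifold (𝓡 n) ∞ M] {g : PseudoRiemannianMetric n M}

namespace PseudoRiemannianMetric

lemma ext_val {x : M} {v v' : TangentSpace (𝓡 n) x} (h : ∀ w, g.val x v w = g.val x v' w) :
    v = v' :=
  sub_eq_zero.1 <| g.nondegenerate x _ fun w => by simp [h]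

lemma sharp_eq_of_val_eq {x : M} {ξ : TangentSpace (𝓡 n) x →L[ℝ] ℝ} {v : TangentSpace (𝓡 n) x}
    (h : ∀ w, g.val x v w = ξ w) : g.sharp x ξ = v :=
  ext_val fun w => by rw [sharp_spec, h]

lemma sharp_val (x : M) (v : TangentSpace (𝓡 n) x) : g.sharp x (g.val x v) = v :=
  sharp_eq_of_val_eq fun _ => rfl

variable (g)

/-- The inverse metric `PseudoRiemannianMetric.cometric` at a point, bundled as a bilinear form. -/
noncomputable def cometricForm (x : M) :
    LinearMap.BilinForm ℝ (TangentSpace (𝓡 n) x →L[ℝ] ℝ) :=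
  LinearMap.mk₂ ℝ (g.cometric x)
    (fun _ _ _ => rfl)
    (fun _ _ _ => rfl)
    (fun ξ ζ ζ' => by
      rw [cometric, sharp_eq_of_val_eq (v := g.sharp x ζ + g.sharp x ζ') fun w => by
        simp [sharp_spec], map_add]
      rfl)
    (fun r ξ ζ => by
      rw [cometric, sharp_eq_of_val_eq (v := r • g.sharp x ζ) fun w => by
        simp [sharp_spec], map_smul]
      rfl)

lemma cometricForm_apply (x : M) (ξ ζ : TangentSpace (𝓡 n) x →L[ℝ] ℝ) :
    g.cometricForm x ξ ζ = g.cometric x ξ ζ :=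
  rfl

lemma cometric_val (x : M) (ξ : TangentSpace (𝓡 n) x →L[ℝ] ℝ) (v : TangentSpace (𝓡 n) x) :
    g.cometric x ξ (g.val x v) = ξ v := by
  rw [cometric, sharp_val]

lemma separatingLeft_cometricForm (x : M) : (g.cometricForm x).SeparatingLeft :=
  fun ξ h => ContinuousLinearMap.ext fun v => by
    rw [← g.cometric_val x ξ v]
    exact h _

end PseudoRiemannianMetric

namespace SpinStructure

variable (S : SpinStructure g) {i : S.ι} {x : M}

lemma val_sum_smul_frame (hx : x ∈ S.U i) (r : Fin n → ℝ) (b : Fin n) :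
    g.val x (∑ a, r a • S.E i a x) (S.E i b x) = r b * S.gam.η b := by
  simp [S.E_orthonormal i x hx]

lemma linearIndependent_frame (hx : x ∈ S.U i) : LinearIndependent ℝ fun a => S.E i a x := by
  rw [Fintype.linearIndependent_iff]
  intro r hr b
  have h := S.val_sum_smul_frame hx r b
  rw [hr, map_zero, zero_apply, eq_comm] at h
  exact (mul_eq_zero.1 h).resolve_right (left_ne_zero_of_mul_eq_one (S.gam.η_mul_self b))

lemma span_frame (hx : x ∈ S.U i) : Submodule.span ℝ (Set.range fun a => S.E i a x) = ⊤ :=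
  have : FiniteDimensional ℝ (TangentSpace (𝓡 n) x) :=
    inferInstanceAs (FiniteDimensional ℝ (EuclideanSpace ℝ (Fin n)))
  (S.linearIndependent_frame hx).span_eq_top_of_card_eq_finrank'
    (finrank_euclideanSpace (𝕜 := ℝ) (ι := Fin n)).symm

lemma sharp_eq_sum (hx : x ∈ S.U i) (ζ : TangentSpace (𝓡 n) x →L[ℝ] ℝ) :
    g.sharp x ζ = ∑ a, (S.gam.η a * ζ (S.E i a x)) • S.E i a x := by
  refine PseudoRiemannianMetric.sharp_eq_of_val_eq fun w => ?_
  refine DFunLike.congr_fun (ContinuousLinearMap.coe_injective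
    (LinearMap.ext_on_range (S.span_frame hx) fun b => ?_)) w
  refine (S.val_sum_smul_frame hx _ b).trans ?_
  rw [mul_right_comm, S.gam.η_mul_self, one_mul]
  rfl

lemma cometric_eq_sum (hx : x ∈ S.U i) (ξ ζ : TangentSpace (𝓡 n) x →L[ℝ] ℝ) :
    g.cometric x ξ ζ = ∑ a, S.gam.η a * ζ (S.E i a x) * ξ (S.E i a x) := by
  simp only [PseudoRiemannianMetric.cometric, S.sharp_eq_sum hx, map_sum, map_smul, smul_eq_mul]

/-- The Clifford action `SpinStructure.c` of covectors, bundled as a real linear map. -/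
noncomputable def cliffordMap (i : S.ι) (x : M) :
    (TangentSpace (𝓡 n) x →L[ℝ] ℝ) →ₗ[ℝ] (SpinorSpace n →L[ℂ] SpinorSpace n) where
  toFun := S.c i x
  map_add' ξ ζ := S.gam.cliffMap.map_add (fun a => ξ (S.E i a x)) fun a => ζ (S.E i a x)
  map_smul' r ξ := S.gam.cliffMap.map_smul r fun a => ξ (S.E i a x)

lemma isCliffordMap_cliffordMap (hx : x ∈ S.U i) :
    IsCliffordMap (g.cometricForm x) (S.cliffordMap i x) := by
  intro ξ ζ
  rw [g.cometricForm_apply, S.cometric_eq_sum hx]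
  refine (S.gam.isCliffordMap_cliffMap _ _).trans ?_
  congr 2
  simp only [Matrix.toBilin'_apply', dotProduct, Matrix.mulVec_diagonal]
  exact Finset.sum_congr rfl fun a _ => mul_comm _ _

end SpinStructure

end Pointwise

section Manifold

lemma nonneg_of_forall_integral_sq_mul_nonneg {E : Type*} [NormedAddCommGroup E] [NormedSpace ℝ E]
    [FiniteDimensional ℝ E] {G : Type*} [TopologicalSpace G] {I : ModelWithCorners ℝ E G}
    {M : Type*} [TopologicalSpace M] [ChartedSpace G M] [IsManifold I ∞ M] [T2Space M]
    [MeasurableSpace M] [BorelSpace M] (m : Measure M) [IsLocallyFiniteMeasure m]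
    [m.IsOpenPosMeasure] {h : M → ℝ} (hc : Continuous h)
    (H : ∀ ρ : M → ℝ, ContMDiff I 𝓘(ℝ, ℝ) ∞ ρ → 0 ≤ ∫ x, ρ x ^ 2 * h x ∂m) (x : M) :
    0 ≤ h x := by
  by_contra! hx
  obtain ⟨ρ, -, hρ⟩ := (SmoothBumpFunction.nhds_basis_tsupport (I := I) x).mem_iff.1
    ((isOpen_lt hc continuous_const).mem_nhds hx)
  have integral_pos : 0 < ∫ y, ρ y ^ 2 * -h y ∂m := by
    refine Continuous.integral_pos_of_hasCompactSupport_nonneg_nonzero (x := x)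
      ((ρ.continuous.pow 2).mul hc.neg) ?_ ?_ ?_
    · exact (ρ.hasCompactSupport.comp_left (g := (· ^ 2)) (by simp)).mul_right
    · intro y
      by_cases hy : ρ y = 0
      · simp [hy]
      · exact mul_nonneg (sq_nonneg _) (neg_pos.2 (hρ (subset_tsupport _ hy))).le
    · simpa using hx.ne
  simp only [mul_neg, integral_neg] at integral_pos
  linarith [H ρ ρ.contMDiff]

variable {n : ℕ} {M : Type*} [TopologicalSpace M] [ChartedSpace (EuclideanSpace ℝ (Fin n)) M]
  {e : OpenPartialHomeomorph M (EuclideanSpace ℝ (Fin n))}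

lemma mdifferentiable_of_mem_maximalAtlas
    (he : e ∈ IsManifold.maximalAtlas (𝓡 n) ∞ M) : e.MDifferentiable (𝓡 n) (𝓡 n) :=
  ⟨(contMDiffOn_of_mem_maximalAtlas he).mdifferentiableOn (by simp),
    (contMDiffOn_symm_of_mem_maximalAtlas he).mdifferentiableOn (by simp)⟩

/-- The basis of the tangent space formed by the coordinate vectors `coordVec` of a chart. -/
noncomputable def coordBasis (he : e ∈ IsManifold.maximalAtlas (𝓡 n) ∞ M)
    {y : EuclideanSpace ℝ (Fin n)} (hy : y ∈ e.target) :
    Module.Basis (Fin n) ℝ (TangentSpace (𝓡 n) (e.symm y)) :=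
  (EuclideanSpace.basisFun (Fin n) ℝ).toBasis.map
    ((mdifferentiable_of_mem_maximalAtlas he).symm.mfderiv hy).toLinearEquiv

lemma coordBasis_apply (he : e ∈ IsManifold.maximalAtlas (𝓡 n) ∞ M)
    {y : EuclideanSpace ℝ (Fin n)} (hy : y ∈ e.target) (μ : Fin n) :
    coordBasis he hy μ = coordVec e μ y := by
  have basisFun_apply :
      (EuclideanSpace.basisFun (Fin n) ℝ).toBasis μ = EuclideanSpace.single μ 1 := by simp
  exact congrArg (mfderiv (𝓡 n) (𝓡 n) e.symm y) basisFun_apply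

variable [IsManifold (𝓡 n) ∞ M]

lemma contMDiffOn_coordVec (he : e ∈ IsManifold.maximalAtlas (𝓡 n) ∞ M) (μ : Fin n) :
    ContMDiffOn (𝓡 n) (𝓡 n).tangent ∞
      (fun y => (⟨e.symm y, coordVec e μ y⟩ : TangentBundle (𝓡 n) M)) e.target := by
  have tangentMap_symm := (contMDiffOn_symm_of_mem_maximalAtlas he).contMDiffOn_tangentMapWithin
    (m := ∞) (by simp) e.open_target.uniqueMDiffOn
  have const : ContMDiff (𝓡 n) (𝓡 n).tangent ∞ (fun y => (⟨y, EuclideanSpace.single μ (1 : ℝ)⟩ :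
      TangentBundle (𝓡 n) (EuclideanSpace ℝ (Fin n)))) :=
    fun y => contMDiffAt_vectorSpace_iff_contDiffAt.2 contDiffAt_const
  refine (tangentMap_symm.comp const.contMDiffOn fun y hy => hy).congr fun y hy => ?_
  simp only [Function.comp_def, tangentMapWithin, coordVec]
  rw [mfderivWithin_of_isOpen e.open_target hy]

namespace PseudoRiemannianMetric

variable (g : PseudoRiemannianMetric n M)

lemma contMDiffWithinAt_val {F : Type*} [NormedAddCommGroup F] [NormedSpace ℝ F] {G : Type*}
    [TopologicalSpace G] {J : ModelWithCorners ℝ F G} {N : Type*} [TopologicalSpace N]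
    [ChartedSpace G N] {b : N → M} {s : Set N} {y : N} {v w : (y : N) → TangentSpace (𝓡 n) (b y)}
    (hv : ContMDiffWithinAt J (𝓡 n).tangent ∞
      (fun y => (⟨b y, v y⟩ : TangentBundle (𝓡 n) M)) s y)
    (hw : ContMDiffWithinAt J (𝓡 n).tangent ∞
      (fun y => (⟨b y, w y⟩ : TangentBundle (𝓡 n) M)) s y) :
    ContMDiffWithinAt J 𝓘(ℝ, ℝ) ∞ (fun y => g.val (b y) (v y) (w y)) s y := by
  have hb : ContMDiffWithinAt J (𝓡 n) ∞ b s y := (Bundle.contMDiffWithinAt_totalSpace.1 hv).1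
  have h := ContMDiffWithinAt.clm_bundle_apply₂ (F₁ := EuclideanSpace ℝ (Fin n))
    (F₂ := EuclideanSpace ℝ (Fin n)) (F₃ := ℝ) (E₃ := Bundle.Trivial M ℝ)
    ((g.smooth (b y)).comp_contMDiffWithinAt y hb) hv hw
  exact (Bundle.contMDiffWithinAt_totalSpace.1 h).2

lemma continuousOn_coordDet (he : e ∈ IsManifold.maximalAtlas (𝓡 n) ∞ M) :
    ContinuousOn (g.coordDet e) e.target := by
  rw [continuousOn_iff_continuous_domRestrict]
  refine Continuous.matrix_det (continuous_matrix fun μ ν => ?_)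
  have continuousOn_val :
      ContinuousOn (fun y => g.val (e.symm y) (coordVec e μ y) (coordVec e ν y)) e.target :=
    fun y hy => (g.contMDiffWithinAt_val (contMDiffOn_coordVec he μ y hy)
    (contMDiffOn_coordVec he ν y hy)).continuousWithinAt
  exact continuousOn_iff_continuous_domRestrict.1 continuousOn_val

lemma coordDet_ne_zero (he : e ∈ IsManifold.maximalAtlas (𝓡 n) ∞ M)
    {y : EuclideanSpace ℝ (Fin n)} (hy : y ∈ e.target) : g.coordDet e y ≠ 0 := by
  set B : LinearMap.BilinForm ℝ (TangentSpace (𝓡 n) (e.symm y)) := (g.val (e.symm y)).toBilinForm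
  have separatingLeft : B.SeparatingLeft := g.nondegenerate (e.symm y)
  have det_ne_zero := Matrix.separatingLeft_iff_det_ne_zero.1
    (LinearMap.BilinForm.SeparatingLeft.toMatrix separatingLeft (coordBasis he hy))
  rw [coordDet]
  convert det_ne_zero using 2
  ext μ ν
  rw [LinearMap.BilinForm.toMatrix_apply, coordBasis_apply, coordBasis_apply]
  rfl

variable {g} [MeasurableSpace M] [BorelSpace M] {m : Measure M}

lemma IsVolume.isLocallyFiniteMeasure (hm : g.IsVolume m) : IsLocallyFiniteMeasure m := by
  refine ⟨fun x => ?_⟩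
  set e := chartAt (EuclideanSpace ℝ (Fin n)) x
  have he : e ∈ IsManifold.maximalAtlas (𝓡 n) ∞ M := IsManifold.chart_mem_maximalAtlas x
  have hx : x ∈ e.source := mem_chart_source _ x
  obtain ⟨K, hK, hxK, hKe⟩ := exists_compact_subset e.open_target (e.map_source hx)
  set s := e.source ∩ e ⁻¹' interior K
  have hs : IsOpen s := e.isOpen_inter_preimage isOpen_interior
  have image_subset : e '' s ⊆ K := by
    rintro _ ⟨z, hz, rfl⟩
    exact interior_subset hz.2
  obtain ⟨C, hC⟩ := hK.exists_bound_of_continuousOn ((g.continuousOn_coordDet he).mono hKe)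
  refine ⟨s, hs.mem_nhds ⟨hx, hxK⟩, ?_⟩
  calc m s = ∫⁻ y in e '' s, ENNReal.ofReal (√|g.coordDet e y|) :=
        hm e he s Set.inter_subset_left hs.measurableSet
    _ ≤ ∫⁻ y in K, ENNReal.ofReal (√|g.coordDet e y|) := lintegral_mono_set image_subset
    _ ≤ ∫⁻ _ in K, ENNReal.ofReal (√C) := setLIntegral_mono' hK.measurableSet fun y hy =>
        ENNReal.ofReal_le_ofReal (Real.sqrt_le_sqrt (hC y hy))
    _ < ⊤ := by
        rw [setLIntegral_const]
        exact ENNReal.mul_lt_top ENNReal.ofReal_lt_top hK.measure_lt_top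

lemma IsVolume.isOpenPosMeasure (hm : g.IsVolume m) : m.IsOpenPosMeasure := by
  refine ⟨fun U hU ⟨x, hx⟩ h0 => ?_⟩
  set e := chartAt (EuclideanSpace ℝ (Fin n)) x
  have he : e ∈ IsManifold.maximalAtlas (𝓡 n) ∞ M := IsManifold.chart_mem_maximalAtlas x
  set s := U ∩ e.source
  have hs : IsOpen s := hU.inter e.open_source
  have image_open : IsOpen (e '' s) := e.isOpen_image_of_subset_source hs Set.inter_subset_right
  have image_subset : e '' s ⊆ e.target := e.mapsTo.mono_left Set.inter_subset_right |>.image_subset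
  have density_pos : ∀ y ∈ e '' s, 0 < ENNReal.ofReal (√|g.coordDet e y|) := fun y hy =>
    ENNReal.ofReal_pos.2 (Real.sqrt_pos.2 (abs_pos.2 (g.coordDet_ne_zero he (image_subset hy))))
  have density_aemeasurable :
      AEMeasurable (fun y => ENNReal.ofReal (√|g.coordDet e y|)) (volume.restrict (e '' s)) :=
    ((ENNReal.continuous_ofReal.comp (Real.continuous_sqrt.comp continuous_abs)).comp_continuousOn
      ((g.continuousOn_coordDet he).mono image_subset)).aemeasurable image_open.measurableSet
  have integral_pos : 0 < ∫⁻ y in e '' s, ENNReal.ofReal (√|g.coordDet e y|) := by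
    have : (ae (volume.restrict (e '' s))).NeBot := by
      rw [ae_neBot, Ne, Measure.restrict_eq_zero]
      exact (image_open.measure_pos volume ⟨e x, x, ⟨hx, mem_chart_source _ x⟩, rfl⟩).ne'
    refine pos_iff_ne_zero.2 fun h => ?_
    rw [lintegral_eq_zero_iff' density_aemeasurable] at h
    obtain ⟨y, hy, density_eq_zero⟩ := ((ae_restrict_mem image_open.measurableSet).and h).exists
    exact (density_pos y hy).ne' density_eq_zero
  rw [← hm e he s Set.inter_subset_right hs.measurableSet] at integral_pos
  exact integral_pos.ne' (measure_mono_null Set.inter_subset_left h0)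

end PseudoRiemannianMetric

end Manifold

section TestSpinors

variable {n : ℕ} {M : Type*} [TopologicalSpace M] [ChartedSpace (EuclideanSpace ℝ (Fin n)) M]

lemma contMDiff_ofReal (f : C^∞⟮𝓡 n, M; ℝ⟯) : ContMDiff (𝓡 n) 𝓘(ℝ, ℂ) ∞ fun x => (f x : ℂ) :=
  Complex.ofRealCLM.contDiff.contMDiff.comp f.contMDiff

variable [IsManifold (𝓡 n) ∞ M]

namespace SpinStructure

variable {g : PseudoRiemannianMetric n M} (S : SpinStructure g)

lemma lam_mem_unitary {i j : S.ι} {x : M} (hx : x ∈ S.U i ∩ S.U j) :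
    S.lam i j x ∈ unitary (SpinorSpace n →L[ℂ] SpinorSpace n) :=
  GammaMatrices.spinGroup_le_unitary (S.lam_mem i j x hx)

lemma lam_self {i : S.ι} {x : M} (hx : x ∈ S.U i) : S.lam i i x = 1 :=
  IsIdempotentElem.iff_eq_one_of_isUnit
    (Unitary.isUnit_coe (U := ⟨_, S.lam_mem_unitary ⟨hx, hx⟩⟩)) |>.1
    (S.lam_cocycle i i i x ⟨⟨hx, hx⟩, hx⟩)

section TestSpinor

variable {S} {i : S.ι} {x : M}

lemma testSpinors_ext {ψ φ : S.testSpinors} (h : ∀ i, ∀ x ∈ S.U i, ψ.1 i x = φ.1 i x) :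
    ψ = φ := by
  refine Subtype.ext (funext fun i => funext fun x => ?_)
  by_cases hx : x ∈ S.U i
  · exact h i x hx
  · rw [ψ.2.1 i x hx, φ.2.1 i x hx]

lemma contMDiffAt_testSpinor (ψ : S.testSpinors) (hx : x ∈ S.U i) :
    ContMDiffAt (𝓡 n) 𝓘(ℝ, SpinorSpace n) ∞ (ψ.1 i) x :=
  (ψ.2.2.2.1 i).contMDiffAt ((S.isOpen_U i).mem_nhds hx)

lemma pointwiseInner_eq (ψ φ : S.testSpinors) (hx : x ∈ S.U i) :
    S.pointwiseInner ψ.1 φ.1 x = ⟪ψ.1 i x, φ.1 i x⟫_ℂ := by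
  have hj := (S.cover x).choose_spec
  rw [pointwiseInner, ψ.2.2.1 _ i x ⟨hj, hx⟩, φ.2.2.1 _ i x ⟨hj, hx⟩]
  exact ContinuousLinearMap.inner_map_map_of_mem_unitary (S.lam_mem_unitary ⟨hj, hx⟩) _ _

lemma continuous_pointwiseInner (ψ φ : S.testSpinors) :
    Continuous (S.pointwiseInner ψ.1 φ.1) := by
  rw [continuous_iff_continuousAt]
  intro x
  obtain ⟨i, hx⟩ := S.cover x
  refine ((contMDiffAt_testSpinor ψ hx).continuousAt.inner (𝕜 := ℂ)
    (contMDiffAt_testSpinor φ hx).continuousAt).congr ?_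
  filter_upwards [(S.isOpen_U i).mem_nhds hx] with y hy
  exact (pointwiseInner_eq ψ φ hy).symm

lemma hasCompactSupport_pointwiseInner [T2Space M] (ψ φ : S.testSpinors) :
    HasCompactSupport (S.pointwiseInner ψ.1 φ.1) := by
  obtain ⟨K, hK, eq_zero⟩ := ψ.2.2.2.2
  exact HasCompactSupport.intro hK fun x hx => by
    rw [pointwiseInner, eq_zero _ x hx, inner_zero_left]

end TestSpinor

/-- Multiplication of a spinor field by a smooth real function. -/
noncomputable def mulReal (f : C^∞⟮𝓡 n, M; ℝ⟯) (ψ : S.testSpinors) : S.testSpinors :=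
  S.mulSpinor (fun x => (f x : ℂ)) (contMDiff_ofReal f) ψ

lemma mulReal_apply (f : C^∞⟮𝓡 n, M; ℝ⟯) (ψ : S.testSpinors) (i : S.ι) (x : M) :
    (S.mulReal f ψ).1 i x = (f x : ℂ) • ψ.1 i x :=
  rfl

/-- The inner product `∫ ψ^*φ dm` of two spinor fields. -/
noncomputable def l2Inner [MeasurableSpace M] (m : Measure M) (ψ φ : S.testSpinors) : ℂ :=
  ∫ x, S.pointwiseInner ψ.1 φ.1 x ∂m

section L2Inner

variable [MeasurableSpace M] {m : Measure M}

lemma l2Inner_congr {ψ φ ψ' φ' : S.testSpinors}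
    (h : ∀ i, ∀ x ∈ S.U i, ⟪ψ.1 i x, φ.1 i x⟫_ℂ = ⟪ψ'.1 i x, φ'.1 i x⟫_ℂ) :
    S.l2Inner m ψ φ = S.l2Inner m ψ' φ' :=
  integral_congr_ae <| .of_forall fun x => h _ x (S.cover x).choose_spec

lemma conj_l2Inner (ψ φ : S.testSpinors) :
    starRingEnd ℂ (S.l2Inner m φ ψ) = S.l2Inner m ψ φ := by
  rw [l2Inner, ← integral_conj]
  simp only [pointwiseInner, inner_conj_symm]
  rfl

lemma l2Inner_mulReal_left (f : C^∞⟮𝓡 n, M; ℝ⟯) (ψ φ : S.testSpinors) :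
    S.l2Inner m (S.mulReal f ψ) φ = S.l2Inner m ψ (S.mulReal f φ) :=
  S.l2Inner_congr fun i x _ => by
    rw [mulReal_apply, mulReal_apply, inner_smul_left, inner_smul_right, Complex.conj_ofReal]

lemma l2Inner_smul_left (z : ℂ) (ψ φ : S.testSpinors) :
    S.l2Inner m (z • ψ) φ = starRingEnd ℂ z * S.l2Inner m ψ φ := by
  rw [l2Inner, l2Inner, ← integral_const_mul]
  congr 1 with x
  exact inner_smul_left _ _ _

variable [T2Space M] [OpensMeasurableSpace M] [IsFiniteMeasureOnCompacts m]

variable (m) in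
lemma integrable_pointwiseInner (ψ φ : S.testSpinors) :
    Integrable (S.pointwiseInner ψ.1 φ.1) m :=
  (continuous_pointwiseInner ψ φ).integrable_of_hasCompactSupport
    (hasCompactSupport_pointwiseInner ψ φ)

lemma l2Inner_sub_left (ψ ψ' φ : S.testSpinors) :
    S.l2Inner m (ψ - ψ') φ = S.l2Inner m ψ φ - S.l2Inner m ψ' φ := by
  rw [l2Inner, l2Inner, l2Inner,
    ← integral_sub (S.integrable_pointwiseInner m ψ φ) (S.integrable_pointwiseInner m ψ' φ)]
  congr 1 with x
  exact inner_sub_left _ _ _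

lemma re_l2Inner (ψ φ : S.testSpinors) :
    (S.l2Inner m ψ φ).re = ∫ x, (S.pointwiseInner ψ.1 φ.1 x).re ∂m :=
  (integral_re (S.integrable_pointwiseInner m ψ φ)).symm

end L2Inner

section Cutoff

variable {ρ : C^∞⟮𝓡 n, M; ℝ⟯} {i j : S.ι}

lemma contMDiffOn_smul_lam_of_tsupport_subset (hρ : tsupport ρ ⊆ S.U i) (s : SpinorSpace n) :
    ContMDiffOn (𝓡 n) 𝓘(ℝ, SpinorSpace n) ∞ (fun y => (ρ y : ℂ) • S.lam j i y s) (S.U j) := by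
  refine fun y hy => ContMDiffAt.contMDiffWithinAt ?_
  by_cases hi : y ∈ S.U i
  · have lam_smooth : ContMDiffAt (𝓡 n) 𝓘(ℝ, SpinorSpace n) ∞ (fun y => S.lam j i y s) y :=
      (((ContinuousLinearMap.apply ℂ (SpinorSpace n) s).restrictScalars
        ℝ).contDiff.contMDiff.comp_contMDiffOn (S.lam_smooth j i)).contMDiffAt
        (((S.isOpen_U j).inter (S.isOpen_U i)).mem_nhds ⟨hy, hi⟩)
    have smul_smooth : ContDiff ℝ ∞ fun p : ℂ × SpinorSpace n => p.1 • p.2 :=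
      contDiff_fst.smul contDiff_snd
    exact smul_smooth.contMDiff.contMDiffAt.comp y
      ((contMDiff_ofReal ρ y).prodMk_space lam_smooth)
  · refine (contMDiffAt_const (c := (0 : SpinorSpace n))).congr_of_eventuallyEq ?_
    filter_upwards [(isClosed_tsupport ρ).isOpen_compl.mem_nhds fun h => hi (hρ h)] with z hz
    rw [image_eq_zero_of_notMem_tsupport hz, Complex.ofReal_zero, zero_smul]

/-- The spinor field which is `ρ s` in the trivialisation `i`, where `ρ` is a cutoff function
supported in `U i`. -/
noncomputable def cutoffSpinor (hc : HasCompactSupport ρ) (hρ : tsupport ρ ⊆ S.U i)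
    (s : SpinorSpace n) : S.testSpinors :=
  ⟨fun j => (S.U j).indicator fun y => (ρ y : ℂ) • S.lam j i y s, by
    refine ⟨fun j y hy => Set.indicator_of_notMem hy _, fun j k y hy => ?_, fun j => ?_,
      tsupport ρ, hc, fun j y hy => ?_⟩
    · beta_reduce
      rw [Set.indicator_of_mem hy.1, Set.indicator_of_mem hy.2, map_smul]
      by_cases hi : y ∈ tsupport ρ
      · rw [← S.lam_cocycle j k i y ⟨hy, hρ hi⟩]
        rfl
      · simp [image_eq_zero_of_notMem_tsupport hi]
    · exact (S.contMDiffOn_smul_lam_of_tsupport_subset hρ s).congr fun y hy =>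
        Set.indicator_of_mem hy _
    · simp [image_eq_zero_of_notMem_tsupport hy]⟩

variable {S} in
lemma cutoffSpinor_apply_self (hc : HasCompactSupport ρ) (hρ : tsupport ρ ⊆ S.U i)
    (s : SpinorSpace n) {x : M} (hx : x ∈ S.U i) :
    (S.cutoffSpinor hc hρ s).1 i x = (ρ x : ℂ) • s := by
  simp [cutoffSpinor, hx, S.lam_self hx]

lemma exists_testSpinor_apply_eq [T2Space M] {x : M} (hx : x ∈ S.U i) (s : SpinorSpace n) :
    ∃ ψ : S.testSpinors, ψ.1 i x = s := by
  obtain ⟨ρ, -, hρ⟩ := (SmoothBumpFunction.nhds_basis_tsupport (I := 𝓡 n) x).mem_iff.1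
    ((S.isOpen_U i).mem_nhds hx)
  let f : C^∞⟮𝓡 n, M; ℝ⟯ := ⟨ρ, ρ.contMDiff⟩
  have f_apply : (f x : ℂ) = 1 := congrArg Complex.ofReal ρ.eq_one
  refine ⟨S.cutoffSpinor (ρ := f) ρ.hasCompactSupport hρ s, ?_⟩
  rw [cutoffSpinor_apply_self _ _ _ hx, f_apply, one_smul]

end Cutoff

end SpinStructure

end TestSpinors

section Symbols

variable {n : ℕ} {M : Type*} [TopologicalSpace M] [ChartedSpace (EuclideanSpace ℝ (Fin n)) M]
  [IsManifold (𝓡 n) ∞ M]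

namespace SpinStructure

variable {g : PseudoRiemannianMetric n M} {S : SpinStructure g}

variable (S) in
/-- The operator `B` on spinor fields is of order zero: in the trivialisation `i` it acts at the
point `x` as the matrix `A i x`. -/
def HasSymbol (B : S.testSpinors → S.testSpinors)
    (A : S.ι → M → SpinorSpace n →L[ℂ] SpinorSpace n) : Prop :=
  ∀ ψ, ∀ i, ∀ x ∈ S.U i, (B ψ).1 i x = A i x (ψ.1 i x)

namespace HasSymbol

variable {B B' : S.testSpinors → S.testSpinors}
  {A A' : S.ι → M → SpinorSpace n →L[ℂ] SpinorSpace n}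

lemma map_mulReal (h : S.HasSymbol B A) (f : C^∞⟮𝓡 n, M; ℝ⟯) (ψ : S.testSpinors) :
    B (S.mulReal f ψ) = S.mulReal f (B ψ) :=
  testSpinors_ext fun i x hx => by
    rw [h _ i x hx, mulReal_apply, mulReal_apply, h _ i x hx, map_smul]

lemma const_smul (h : S.HasSymbol B A) (z : ℂ) :
    S.HasSymbol (fun ψ => z • B ψ) fun i x => z • A i x :=
  fun ψ i x hx => congrArg (z • ·) (h ψ i x hx)

lemma comp (h : S.HasSymbol B A) (h' : S.HasSymbol B' A') :
    S.HasSymbol (fun ψ => B (B' ψ)) fun i x => A i x * A' i x :=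
  fun ψ i x hx => by rw [h _ i x hx, h' ψ i x hx, mul_apply_eq_comp]

lemma sub_smul (h : S.HasSymbol B A) (z : ℂ) :
    S.HasSymbol (fun ψ => B ψ - z • ψ) fun i x => A i x - z • 1 :=
  fun ψ i x hx => congrArg (· - z • ψ.1 i x) (h ψ i x hx)

variable [T2Space M] [MeasurableSpace M] [BorelSpace M] {m : Measure M}
  [IsLocallyFiniteMeasure m] [m.IsOpenPosMeasure]

lemma re_inner_nonneg (h : S.HasSymbol B A) (hB : ∀ ψ, 0 ≤ (S.l2Inner m (B ψ) ψ).re)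
    {i : S.ι} {x : M} (hx : x ∈ S.U i) (s : SpinorSpace n) : 0 ≤ (⟪A i x s, s⟫_ℂ).re := by
  obtain ⟨ψ, rfl⟩ := S.exists_testSpinor_apply_eq hx s
  rw [← h ψ i x hx, ← pointwiseInner_eq _ _ hx]
  refine nonneg_of_forall_integral_sq_mul_nonneg (I := 𝓡 n) m
    (h := fun y => (S.pointwiseInner (B ψ).1 ψ.1 y).re)
    (Complex.continuous_re.comp (continuous_pointwiseInner _ _)) (fun ρ hρ => ?_) x
  let f : C^∞⟮𝓡 n, M; ℝ⟯ := ⟨ρ, hρ⟩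
  have pointwise_eq (y : M) : (S.pointwiseInner (S.mulReal f (B ψ)).1 (S.mulReal f ψ).1 y).re =
      ρ y ^ 2 * (S.pointwiseInner (B ψ).1 ψ.1 y).re := by
    simp only [pointwiseInner, mulReal_apply, inner_smul_left, inner_smul_right,
      Complex.conj_ofReal, Complex.re_ofReal_mul]
    rw [pow_two, mul_assoc]
    rfl
  simpa only [h.map_mulReal, re_l2Inner, pointwise_eq] using hB (S.mulReal f ψ)

lemma isSelfAdjoint (h : S.HasSymbol B A) (hB : ∀ ψ, (S.l2Inner m (B ψ) ψ).im = 0)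
    {i : S.ι} {x : M} (hx : x ∈ S.U i) : IsSelfAdjoint (A i x) := by
  rw [ContinuousLinearMap.isSelfAdjoint_iff_isSymmetric,
    LinearMap.isSymmetric_iff_inner_map_self_real]
  intro s
  have re_conj_mul_nonneg (z : ℂ) (hz : z.re = 0) :
      0 ≤ (starRingEnd ℂ z * ⟪A i x s, s⟫_ℂ).re := by
    have nonneg := (h.const_smul z).re_inner_nonneg (m := m) (fun ψ => ?_) hx s
    · rwa [smul_apply, inner_smul_left] at nonneg
    · simp [l2Inner_smul_left, hz, hB]
  have im_nonneg := re_conj_mul_nonneg Complex.I Complex.I_re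
  have im_nonpos := re_conj_mul_nonneg (-Complex.I) (by simp)
  simp only [map_neg, Complex.conj_I, neg_neg, neg_mul, Complex.neg_re, Complex.I_mul_re]
    at im_nonneg im_nonpos
  have im_eq_zero : (⟪A i x s, s⟫_ℂ).im = 0 := by linarith
  exact Complex.conj_eq_iff_im.2 im_eq_zero

end HasSymbol

section Leibniz

omit [IsManifold (𝓡 n) ∞ M] in
lemma spinorDeriv_smul {f : M → ℝ} {ψ : M → SpinorSpace n} {x : M}
    (hf : MDifferentiableAt (𝓡 n) 𝓘(ℝ, ℝ) f x)
    (hψ : MDifferentiableAt (𝓡 n) 𝓘(ℝ, SpinorSpace n) ψ x) (v : TangentSpace (𝓡 n) x) :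
    spinorDeriv (fun y => (f y : ℂ) • ψ y) x v =
      (f x : ℂ) • spinorDeriv ψ x v + (differential f x v : ℂ) • ψ x := by
  have hfψ : HasMFDerivAt (𝓡 n) 𝓘(ℝ, SpinorSpace n) (fun y => (f y : ℂ) • ψ y) x _ :=
    ⟨(Complex.continuous_ofReal.continuousAt.comp hf.hasMFDerivAt.1).smul hψ.hasMFDerivAt.1,
      (Complex.ofRealCLM.hasFDerivAt.comp_hasFDerivWithinAt _ hf.hasMFDerivAt.2).smul
        hψ.hasMFDerivAt.2⟩
  rw [spinorDeriv, hfψ.mfderiv]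
  simp only [writtenInExtChartAt, Function.comp_apply, mfld_simps]
  rfl

lemma nabla_smul {f : M → ℝ} {ψ : M → SpinorSpace n} {x : M}
    (hf : MDifferentiableAt (𝓡 n) 𝓘(ℝ, ℝ) f x)
    (hψ : MDifferentiableAt (𝓡 n) 𝓘(ℝ, SpinorSpace n) ψ x) (i : S.ι) (a : Fin n) :
    S.nabla i a (fun y => (f y : ℂ) • ψ y) x =
      (f x : ℂ) • S.nabla i a ψ x + (differential f x (S.E i a x) : ℂ) • ψ x := by
  simp only [nabla, spinorDeriv_smul hf hψ, map_smul, smul_add, Finset.smul_sum,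
    smul_comm (f x : ℂ)]
  abel

variable (S) in
/-- The commutator `[D, f]` of an operator on spinor fields with a smooth real function. -/
noncomputable def commutator (D : S.testSpinors → S.testSpinors) (f : C^∞⟮𝓡 n, M; ℝ⟯)
    (ψ : S.testSpinors) : S.testSpinors :=
  D (S.mulReal f ψ) - S.mulReal f (D ψ)

variable {D : S.testSpinors → S.testSpinors}

lemma hasSymbol_commutator (hD : ∀ ψ, S.IsDirac ψ.1 (D ψ).1) (f : C^∞⟮𝓡 n, M; ℝ⟯) :
    S.HasSymbol (S.commutator D f) fun i x => (-Complex.I) • S.c i x (differential f x) := by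
  intro ψ i x hx
  have hf : MDifferentiableAt (𝓡 n) 𝓘(ℝ, ℝ) f x := (f.contMDiff x).mdifferentiableAt (by simp)
  have hψ := (contMDiffAt_testSpinor ψ hx).mdifferentiableAt (by simp)
  change (D (S.mulReal f ψ)).1 i x - (f x : ℂ) • (D ψ).1 i x = _
  rw [hD _ i x hx, hD _ i x hx]
  change (-Complex.I) • ∑ a, S.gam.γ a (S.nabla i a (fun y => (f y : ℂ) • ψ.1 i y) x) - _ = _
  simp only [nabla_smul hf hψ, map_add, map_smul, Finset.sum_add_distrib, smul_add,
    ← Finset.smul_sum, smul_comm (f x : ℂ), c, GammaMatrices.cliff, sum_apply, smul_apply]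
  abel

lemma HasSymbol.commutator_comp {J : S.testSpinors → S.testSpinors}
    {A A' : S.ι → M → SpinorSpace n →L[ℂ] SpinorSpace n} {f : C^∞⟮𝓡 n, M; ℝ⟯}
    (hJ : S.HasSymbol J A) (hD : S.HasSymbol (S.commutator D f) A') :
    S.HasSymbol (S.commutator (fun ψ => J (D ψ)) f) fun i x => A i x * A' i x := by
  intro ψ i x hx
  change (J (D (S.mulReal f ψ))).1 i x - (f x : ℂ) • (J (D ψ)).1 i x = A i x (A' i x (ψ.1 i x))
  rw [hJ _ i x hx, hJ _ i x hx, ← hD ψ i x hx, ← map_smul, ← map_sub]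
  rfl

lemma im_l2Inner_commutator_of_skew [T2Space M] [MeasurableSpace M] [OpensMeasurableSpace M]
    {m : Measure M} [IsFiniteMeasureOnCompacts m]
    (hD : ∀ ψ φ, S.l2Inner m (D ψ) φ = -S.l2Inner m ψ (D φ)) (f : C^∞⟮𝓡 n, M; ℝ⟯)
    (ψ : S.testSpinors) : (S.l2Inner m (S.commutator D f ψ) ψ).im = 0 := by
  rw [commutator, l2Inner_sub_left, hD, l2Inner_mulReal_left, l2Inner_mulReal_left,
    ← conj_l2Inner, l2Inner_mulReal_left]
  simp

end Leibniz

end SpinStructure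

end Symbols

section TemporalDirac

variable {n : ℕ} {M : Type*} [TopologicalSpace M] [ChartedSpace (EuclideanSpace ℝ (Fin n)) M]
  [IsManifold (𝓡 n) ∞ M]

lemma exists_differential_eq [T2Space M] (x : M) (ξ : TangentSpace (𝓡 n) x →L[ℝ] ℝ) :
    ∃ f : C^∞⟮𝓡 n, M; ℝ⟯, differential f x = ξ := by
  let ρ : SmoothBumpFunction (𝓡 n) x := Classical.arbitrary _
  let ξ' : EuclideanSpace ℝ (Fin n) →L[ℝ] ℝ := ξ
  refine ⟨⟨fun y => ρ y • ξ' (extChartAt (𝓡 n) x y), ρ.contMDiff_smul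
    (ξ'.contDiff.contMDiff.comp_contMDiffOn contMDiffOn_extChartAt)⟩, ?_⟩
  have eventuallyEq : (fun y => ρ y • ξ' (extChartAt (𝓡 n) x y)) =ᶠ[𝓝 x]
      fun y => ξ' (extChartAt (𝓡 n) x y) := by
    filter_upwards [ρ.eventuallyEq_one] with y hy
    simp [hy]
  have hasMFDerivAt : HasMFDerivAt (𝓡 n) 𝓘(ℝ, ℝ) (fun y => ξ' (extChartAt (𝓡 n) x y)) x ξ := by
    refine ⟨ξ'.continuous.continuousAt.comp (continuousAt_extChartAt x), ?_⟩
    refine ξ'.hasFDerivAt.hasFDerivWithinAt.congr_of_eventuallyEq ?_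
      (by simp only [mfld_simps]; rfl)
    filter_upwards [extChartAt_target_mem_nhdsWithin x] with y hy
    simp only [writtenInExtChartAt, Function.comp_apply, extChartAt_model_space_eq_id,
      PartialEquiv.refl_coe, id]
    rw [(extChartAt (𝓡 n) x).right_inv hy]
  exact eventuallyEq.mfderiv_eq.trans hasMFDerivAt.mfderiv

section Algebra

variable {A : Type*} [Ring A] [StarRing A] [Algebra ℂ A] {t y : A}

lemma isSelfAdjoint_mul_of_neg_I_smul
    (h : IsSelfAdjoint (((-Complex.I) • t) * ((-Complex.I) • y))) : IsSelfAdjoint (t * y) := by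
  rw [smul_mul_smul_comm, neg_mul_neg, Complex.I_mul_I, neg_one_smul] at h
  simpa using h.neg

lemma star_eq_neg_of_isSelfAdjoint_neg_I_smul [StarModule ℂ A]
    (h : IsSelfAdjoint ((-Complex.I) • t)) : star t = -t := by
  have star_smul_eq := h.star_eq
  rw [star_smul, star_neg, Complex.star_def, Complex.conj_I, neg_neg, neg_smul, ← smul_neg]
    at star_smul_eq
  exact smul_right_injective _ Complex.I_ne_zero star_smul_eq

end Algebra

lemma re_inner_neg_I_smul_sq_sub_smul {V : Type*} [NormedAddCommGroup V] [InnerProductSpace ℂ V]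
    {T : V →L[ℂ] V} {r : ℝ} (hT : T * T = algebraMap ℝ (V →L[ℂ] V) r) (c : ℝ) (s : V) :
    (⟪(((-Complex.I) • T) * ((-Complex.I) • T) - (c : ℂ) • (1 : V →L[ℂ] V)) s, s⟫_ℂ).re =
      (-r - c) * ‖s‖ ^ 2 := by
  have apply_eq : (((-Complex.I) • T) * ((-Complex.I) • T) - (c : ℂ) • (1 : V →L[ℂ] V)) s =
      ((-r - c : ℝ) : ℂ) • s := by
    rw [smul_mul_smul_comm, hT, neg_mul_neg, Complex.I_mul_I, neg_one_smul, sub_apply, neg_apply,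
      Algebra.algebraMap_eq_smul_one, smul_apply, smul_apply, one_apply_eq_self, Complex.ofReal_sub,
      Complex.ofReal_neg, sub_smul, neg_smul, Complex.coe_smul, Complex.coe_smul]
  rw [apply_eq, inner_smul_left, Complex.conj_ofReal, Complex.re_ofReal_mul]
  exact congrArg _ (inner_self_eq_norm_sq (𝕜 := ℂ) s)

namespace SpinStructure

variable {g : PseudoRiemannianMetric n M}

/-- The part of the structure of a temporal spectral triple which survives on smooth compactly
supported spinor fields: `D` is the Dirac operator, `[D, τ]` is symmetric and bounded below, and
`[D, τ] D` is skew-symmetric, for the `L²` inner product of the measure `m`. -/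
structure IsTemporalDirac [MeasurableSpace M] (S : SpinStructure g) (m : Measure M)
    (D : S.testSpinors → S.testSpinors) (τ : C^∞⟮𝓡 n, M; ℝ⟯) : Prop where
  isDirac : ∀ ψ, S.IsDirac ψ.1 (D ψ).1
  symmetric : ∀ ψ φ, S.l2Inner m (S.commutator D τ ψ) φ = S.l2Inner m ψ (S.commutator D τ φ)
  coercive : ∃ c > 0, ∀ ψ, c * (S.l2Inner m ψ ψ).re ≤
    (S.l2Inner m (S.commutator D τ ψ) (S.commutator D τ ψ)).re
  skew : ∀ ψ φ, S.l2Inner m (S.commutator D τ (D ψ)) φ = -S.l2Inner m ψ (S.commutator D τ (D φ))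

namespace IsTemporalDirac

variable [T2Space M] [MeasurableSpace M] [BorelSpace M] {S : SpinStructure g} {m : Measure M}
  [IsLocallyFiniteMeasure m] [m.IsOpenPosMeasure]
  {D : S.testSpinors → S.testSpinors} {τ : C^∞⟮𝓡 n, M; ℝ⟯} {i : S.ι} {x : M}

lemma star_c_eq (h : S.IsTemporalDirac m D τ) (hx : x ∈ S.U i) :
    star (S.c i x (differential τ x)) = -S.c i x (differential τ x) := by
  refine star_eq_neg_of_isSelfAdjoint_neg_I_smul (A := SpinorSpace n →L[ℂ] SpinorSpace n)
    ((hasSymbol_commutator h.isDirac τ).isSelfAdjoint (m := m) (fun ψ => ?_) hx)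
  rw [← Complex.conj_eq_iff_im, conj_l2Inner, h.symmetric]

lemma isSelfAdjoint_c_mul_c (h : S.IsTemporalDirac m D τ) (hx : x ∈ S.U i)
    (ξ : TangentSpace (𝓡 n) x →L[ℝ] ℝ) :
    IsSelfAdjoint (S.c i x (differential τ x) * S.c i x ξ) := by
  obtain ⟨f, rfl⟩ := exists_differential_eq x ξ
  exact isSelfAdjoint_mul_of_neg_I_smul (A := SpinorSpace n →L[ℂ] SpinorSpace n)
    (((hasSymbol_commutator h.isDirac τ).commutator_comp
      (hasSymbol_commutator h.isDirac f)).isSelfAdjoint (im_l2Inner_commutator_of_skew h.skew f) hx)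

lemma cometric_neg (h : S.IsTemporalDirac m D τ) (x : M) :
    g.cometric x (differential τ x) (differential τ x) < 0 := by
  obtain ⟨i, hx⟩ := S.cover x
  obtain ⟨c, c_pos, le⟩ := h.coercive
  obtain ⟨s, hs⟩ := exists_ne (0 : SpinorSpace n)
  have symbol := hasSymbol_commutator h.isDirac τ
  have nonneg := ((symbol.comp symbol).sub_smul c).re_inner_nonneg (m := m) (fun ψ => ?_) hx s
  · have c_mul_self : S.c i x (differential τ x) * S.c i x (differential τ x) =
        algebraMap ℝ (SpinorSpace n →L[ℂ] SpinorSpace n)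
          (g.cometric x (differential τ x) (differential τ x)) :=
      (S.isCliffordMap_cliffordMap hx).mul_self _
    rw [re_inner_neg_I_smul_sq_sub_smul c_mul_self] at nonneg
    linarith [nonneg_of_mul_nonneg_left nonneg (by positivity)]
  · rw [l2Inner_sub_left, h.symmetric, l2Inner_smul_left, Complex.conj_ofReal, Complex.sub_re,
      Complex.re_ofReal_mul]
    exact sub_nonneg.2 (le ψ)

lemma isTemporal (h : S.IsTemporalDirac m D τ) (hx : x ∈ S.U i) :
    IsTemporal (g.cometricForm x) (S.cliffordMap i x) (differential τ x) where
  neg := h.cometric_neg x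
  star_eq := h.star_c_eq hx
  isSelfAdjoint_mul := h.isSelfAdjoint_c_mul_c hx

end IsTemporalDirac

end SpinStructure

end TemporalDirac

section SpectralTriple

variable {H : Type*} [NormedAddCommGroup H] [InnerProductSpace ℂ H]

namespace UnboundedOp

lemma mem_graph_mul {f g : H →ₗ.[ℂ] H} {x y z : H} (hg : (x, y) ∈ g.graph)
    (hf : (y, z) ∈ f.graph) : (x, z) ∈ (mul f g).graph := by
  rw [LinearPMap.mem_graph_iff] at hf hg ⊢
  obtain ⟨⟨x, hx⟩, rfl, rfl⟩ := hg
  obtain ⟨⟨y, hy⟩, h, rfl⟩ := hf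
  obtain rfl : y = g ⟨x, hx⟩ := h
  exact ⟨⟨x, hx, hy⟩, rfl, rfl⟩

lemma mem_graph_ofBounded (B : H →L[ℂ] H) (x : H) : (x, B x) ∈ (ofBounded B).graph :=
  (LinearPMap.mem_graph_iff _).2 ⟨⟨x, trivial⟩, rfl, rfl⟩

lemma sub_mem_graph_sub {f g : H →ₗ.[ℂ] H} {x y z : H} (hf : (x, y) ∈ f.graph)
    (hg : (x, z) ∈ g.graph) : (x, y - z) ∈ (f - g).graph := by
  rw [LinearPMap.mem_graph_iff] at hf hg ⊢
  obtain ⟨⟨x, hx⟩, rfl, rfl⟩ := hf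
  obtain ⟨⟨_, hx'⟩, rfl, rfl⟩ := hg
  exact ⟨⟨_, hx, hx'⟩, rfl, rfl⟩

lemma ClosureIsBounded.eq_of_mem_graph {P : H →ₗ.[ℂ] H} {B : H →L[ℂ] H}
    (h : ClosureIsBounded P B) {x y : H} (hxy : (x, y) ∈ P.graph) : B x = y :=
  ((h x y).1 (Submodule.le_topologicalClosure _ hxy)).symm

lemma inner_eq_neg_of_adjoint_eq_neg [CompleteSpace H] {P : H →ₗ.[ℂ] H}
    (hd : Dense (P.domain : Set H)) (hP : P.adjoint = -P) {x x' y y' : H}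
    (hx : (x, x') ∈ P.graph) (hy : (y, y') ∈ P.graph) : ⟪x', y⟫_ℂ = -⟪x, y'⟫_ℂ := by
  rw [LinearPMap.mem_graph_iff] at hx hy
  obtain ⟨x, rfl, rfl⟩ := hx
  obtain ⟨y, rfl, rfl⟩ := hy
  have isFormalAdjoint := LinearPMap.adjoint_isFormalAdjoint hd
  rw [hP] at isFormalAdjoint
  rw [← isFormalAdjoint x y, LinearPMap.neg_apply, inner_neg_left, neg_neg]

end UnboundedOp

lemma exists_pos_mul_norm_sq_le {B : H →L[ℂ] H} (hB : IsUnit B) :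
    ∃ c > 0, ∀ x, c * ‖x‖ ^ 2 ≤ ‖B x‖ ^ 2 := by
  obtain ⟨u, rfl⟩ := hB
  set e := ContinuousLinearEquiv.ofUnit u
  obtain ⟨K, hK, bound⟩ := e.symm.toContinuousLinearMap.bound
  refine ⟨(K ^ 2)⁻¹, by positivity, fun x => ?_⟩
  rw [inv_mul_le_iff₀ (by positivity), ← mul_pow]
  have norm_le : ‖x‖ ≤ K * ‖e x‖ := by simpa using bound (e x)
  exact pow_le_pow_left₀ (norm_nonneg x) norm_le 2

variable [CompleteSpace H]

lemma TemporalLorentzianSpectralTriple.isUnit_commDT (X : TemporalLorentzianSpectralTriple H) :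
    IsUnit X.commDT :=
  isUnit_mul_self_iff.1 X.commDT_sq_pos.isUnit

namespace ComesFromSpinManifold

variable {n : ℕ} {M : Type*} [TopologicalSpace M] [ChartedSpace (EuclideanSpace ℝ (Fin n)) M]
  [IsManifold (𝓡 n) ∞ M] [MeasurableSpace M] {g : PseudoRiemannianMetric n M}
  {X : TemporalLorentzianSpectralTriple H} {S : SpinStructure g} {time : M → ℝ}
  (hS : ComesFromSpinManifold X S time)

/-- The time function, bundled as a smooth real function. -/
noncomputable def timeFunction : C^∞⟮𝓡 n, M; ℝ⟯ :=
  ⟨time, Complex.reCLM.contDiff.contMDiff.comp hS.time_smooth⟩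

lemma exists_dirac : ∃ D : S.testSpinors → S.testSpinors,
    ∀ ψ, S.IsDirac ψ.1 (D ψ).1 ∧ (hS.toH ψ, hS.toH (D ψ)) ∈ X.D.graph :=
  Classical.skolem.1 hS.D_dirac

variable {D : S.testSpinors → S.testSpinors}
  (hD : ∀ ψ, (hS.toH ψ, hS.toH (D ψ)) ∈ X.D.graph)

include hD

lemma commDT_toH (ψ : S.testSpinors) :
    X.commDT (hS.toH ψ) = hS.toH (S.commutator D hS.timeFunction ψ) :=
  UnboundedOp.ClosureIsBounded.eq_of_mem_graph X.commDT_eq <| by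
    rw [SpinStructure.commutator, map_sub]
    exact UnboundedOp.sub_mem_graph_sub (UnboundedOp.mem_graph_mul (hS.T_mul ψ) (hD _))
      (UnboundedOp.mem_graph_mul (hD ψ) (hS.T_mul _))

lemma mem_graph_commDT_mul_D (ψ : S.testSpinors) :
    (hS.toH ψ, hS.toH (S.commutator D hS.timeFunction (D ψ))) ∈
      (UnboundedOp.mul (UnboundedOp.ofBounded X.commDT) X.D).graph := by
  rw [← hS.commDT_toH hD]
  exact UnboundedOp.mem_graph_mul (hD ψ) (UnboundedOp.mem_graph_ofBounded _ _)

lemma dense_domain_commDT_mul_D :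
    Dense ((UnboundedOp.mul (UnboundedOp.ofBounded X.commDT) X.D).domain : Set H) := by
  refine hS.dense_toH.mono ?_
  rintro _ ⟨ψ, rfl⟩
  exact LinearPMap.mem_domain_of_mem_graph (hS.mem_graph_commDT_mul_D hD ψ)

omit hD

lemma exists_isTemporalDirac : ∃ D, S.IsTemporalDirac hS.vol D hS.timeFunction := by
  obtain ⟨D, hD⟩ := hS.exists_dirac
  have mem_graph ψ := (hD ψ).2
  have commDT_isSymmetric :=
    ContinuousLinearMap.isSelfAdjoint_iff_isSymmetric.1 X.commDT_selfAdjoint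
  refine ⟨D, fun ψ => (hD ψ).1, fun ψ φ => ?_, ?_, fun ψ φ => ?_⟩
  · have symm := commDT_isSymmetric (hS.toH ψ) (hS.toH φ)
    rwa [ContinuousLinearMap.coe_coe, hS.commDT_toH mem_graph, hS.commDT_toH mem_graph,
      hS.inner_toH, hS.inner_toH] at symm
  · obtain ⟨c, c_pos, le⟩ := exists_pos_mul_norm_sq_le X.isUnit_commDT
    refine ⟨c, c_pos, fun ψ => ?_⟩
    have le_ψ := le (hS.toH ψ)
    rwa [hS.commDT_toH mem_graph, ← inner_self_eq_norm_sq (𝕜 := ℂ),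
      ← inner_self_eq_norm_sq (𝕜 := ℂ), hS.inner_toH, hS.inner_toH] at le_ψ
  · have skew := UnboundedOp.inner_eq_neg_of_adjoint_eq_neg
      (hS.dense_domain_commDT_mul_D mem_graph) X.skewAdjoint
      (hS.mem_graph_commDT_mul_D mem_graph ψ) (hS.mem_graph_commDT_mul_D mem_graph φ)
    rwa [hS.inner_toH, hS.inner_toH] at skew

end ComesFromSpinManifold

end SpectralTriple

section Splitting

variable {n : ℕ} {M : Type*} [TopologicalSpace M] [ChartedSpace (EuclideanSpace ℝ (Fin n)) M]

lemma differential_coordFun_coordVec {e : OpenPartialHomeomorph M (EuclideanSpace ℝ (Fin n))}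
    (he : e ∈ IsManifold.maximalAtlas (𝓡 n) ∞ M) {y : EuclideanSpace ℝ (Fin n)}
    (hy : y ∈ e.target) (μ ν : Fin n) :
    differential (coordFun e μ) (e.symm y) (coordVec e ν y) = if μ = ν then 1 else 0 := by
  have he' := mdifferentiable_of_mem_maximalAtlas he
  let proj : EuclideanSpace ℝ (Fin n) →L[ℝ] ℝ := EuclideanSpace.proj μ
  have coordFun_hasMFDerivAt : HasMFDerivAt (𝓡 n) 𝓘(ℝ, ℝ) (coordFun e μ) (e.symm y)
      (proj.comp (mfderiv (𝓡 n) (𝓡 n) e (e.symm y))) :=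
    proj.hasMFDerivAt.comp (e.symm y) (he'.mdifferentiableAt (e.map_target hy)).hasMFDerivAt
  have coordFun_comp_symm : coordFun e μ ∘ e.symm =ᶠ[𝓝 y] proj := by
    filter_upwards [e.open_target.mem_nhds hy] with z hz
    simp [coordFun, proj, e.right_inv hz]
  have mfderiv_comp_symm := hasMFDerivAt_unique
    ((coordFun_hasMFDerivAt.comp y (he'.symm.mdifferentiableAt hy).hasMFDerivAt)
      |>.congr_of_eventuallyEq coordFun_comp_symm.symm) proj.hasMFDerivAt
  rw [differential, coordFun_hasMFDerivAt.mfderiv]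
  refine (congrArg (fun L : EuclideanSpace ℝ (Fin n) →L[ℝ] ℝ =>
    L (EuclideanSpace.single ν (1 : ℝ))) mfderiv_comp_symm).trans ?_
  simp [proj]

lemma differential_coordFun_notMem_span
    {e : OpenPartialHomeomorph M (EuclideanSpace ℝ (Fin n))}
    (he : e ∈ IsManifold.maximalAtlas (𝓡 n) ∞ M) {x : M} (hx : x ∈ e.source) {μ ν : Fin n}
    (hμν : μ ≠ ν) :
    differential (n := n) (coordFun e μ) x ∉
      Submodule.span ℝ {differential (n := n) (coordFun e ν) x} := by
  obtain ⟨y, hy, rfl⟩ : ∃ y ∈ e.target, e.symm y = x := ⟨e x, e.map_source hx, e.left_inv hx⟩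
  rw [Submodule.mem_span_singleton]
  rintro ⟨r, hr⟩
  have apply_coordVec := DFunLike.congr_fun hr (coordVec e μ y)
  simp [differential_coordFun_coordVec he hy, hμν.symm] at apply_coordVec

lemma differential_coordFun_eq {e : OpenPartialHomeomorph M (EuclideanSpace ℝ (Fin n))}
    {τ : M → ℝ} {k : Fin n} (hk : ∀ y ∈ e.source, coordFun e k y = τ y) {x : M}
    (hx : x ∈ e.source) :
    differential (n := n) (coordFun e k) x = differential τ x :=
  Filter.EventuallyEq.mfderiv_eq (Filter.mem_of_superset (e.open_source.mem_nhds hx) hk)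

variable [IsManifold (𝓡 n) ∞ M]

section Smoothness

variable {τ : M → ℝ}

lemma contMDiffAt_differential_comp_symmL (hτ : ContMDiff (𝓡 n) 𝓘(ℝ, ℝ) ∞ τ) (x₀ : M) :
    ContMDiffAt (𝓡 n) 𝓘(ℝ, EuclideanSpace ℝ (Fin n) →L[ℝ] ℝ) ∞
      (fun x => (differential τ x).comp ((trivializationAt (EuclideanSpace ℝ (Fin n))
        (TangentSpace (𝓡 n) : M → Type _) x₀).symmL ℝ x)) x₀ := by
  refine ((hτ x₀).mfderiv_const (m := ∞) (by simp)).congr_of_eventuallyEq (.of_forall fun x => ?_)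
  ext v
  simp only [inTangentCoordinates, ContinuousLinearMap.inCoordinates, differential,
    TangentBundle.continuousLinearMapAt_model_space]
  rfl

lemma isSmoothTwoTensor_differential_sq (hτ : ContMDiff (𝓡 n) 𝓘(ℝ, ℝ) ∞ τ) :
    IsSmoothTwoTensor (n := n) (M := M)
      fun x => (differential τ x).smulRight (differential τ x) := by
  intro x₀
  rw [Bundle.contMDiffAt_section]
  have smulRight_smooth : ContDiff ℝ ∞ fun ξ : EuclideanSpace ℝ (Fin n) →L[ℝ] ℝ => ξ.smulRight ξ :=
    contDiff_id.smulRight contDiff_id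
  refine (smulRight_smooth.contMDiff.contMDiffAt.comp x₀
    (contMDiffAt_differential_comp_symmL hτ x₀)).congr_of_eventuallyEq ?_
  filter_upwards [(trivializationAt (EuclideanSpace ℝ (Fin n))
    (TangentSpace (𝓡 n) : M → Type _) x₀).open_baseSet.mem_nhds
    (FiberBundle.mem_baseSet_trivializationAt' x₀)] with x hx
  ext v w
  have hx' : x ∈ (trivializationAt (EuclideanSpace ℝ (Fin n) →L[ℝ] ℝ)
      (fun x : M => TangentSpace (𝓡 n) x →L[ℝ] ℝ) x₀).baseSet := ⟨hx, trivial⟩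
  simp only [hom_trivializationAt_apply, ContinuousLinearMap.inCoordinates,
    ContinuousLinearMap.coe_comp, Function.comp_apply]
  rw [Bundle.Trivialization.continuousLinearMapAt_apply, Bundle.Trivialization.linearMapAt_apply,
    if_pos hx', hom_trivializationAt_apply]
  simp only [ContinuousLinearMap.inCoordinates, Bundle.Trivial.fiberBundle_trivializationAt',
    Bundle.Trivial.continuousLinearMapAt_trivialization]
  rfl

lemma contMDiffAt_differential_apply (hτ : ContMDiff (𝓡 n) 𝓘(ℝ, ℝ) ∞ τ)
    {E : (x : M) → TangentSpace (𝓡 n) x} {x : M}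
    (hE : ContMDiffAt (𝓡 n) (𝓡 n).tangent ∞ (fun x => (⟨x, E x⟩ : TangentBundle (𝓡 n) M)) x) :
    ContMDiffAt (𝓡 n) 𝓘(ℝ, ℝ) ∞ (fun x => differential τ x (E x)) x :=
  (contMDiff_snd_tangentBundle_modelSpace ℝ 𝓘(ℝ, ℝ)).contMDiffAt.comp x
    ((hτ.contMDiff_tangentMap (m := ∞) (by simp)).contMDiffAt.comp x hE)

lemma SpinStructure.contMDiff_cometric_differential {g : PseudoRiemannianMetric n M}
    (S : SpinStructure g) (hτ : ContMDiff (𝓡 n) 𝓘(ℝ, ℝ) ∞ τ) :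
    ContMDiff (𝓡 n) 𝓘(ℝ, ℝ) ∞ fun x => g.cometric x (differential τ x) (differential τ x) := by
  intro x
  obtain ⟨i, hx⟩ := S.cover x
  have frame_smooth (a) : ContMDiffAt (𝓡 n) 𝓘(ℝ, ℝ) ∞ (fun x => differential τ x (S.E i a x)) x :=
    contMDiffAt_differential_apply hτ
      ((S.E_smooth i a).contMDiffAt ((S.isOpen_U i).mem_nhds hx))
  have sum_smooth : ContMDiffAt (𝓡 n) 𝓘(ℝ, ℝ) ∞ (fun x => ∑ a, S.gam.η a *
      differential τ x (S.E i a x) * differential τ x (S.E i a x)) x :=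
    ContMDiffAt.sum fun a _ => (contMDiffAt_const.mul (frame_smooth a)).mul (frame_smooth a)
  refine sum_smooth.congr_of_eventuallyEq ?_
  filter_upwards [(S.isOpen_U i).mem_nhds hx] with y hy
  exact S.cometric_eq_sum hy _ _

end Smoothness

namespace PseudoRiemannianMetric

variable {g : PseudoRiemannianMetric n M}

lemma isLorentzian_of_forall_exists_covector
    (h : ∀ x, ∃ ξ, g.cometric x ξ ξ < 0 ∧ ∀ v, ξ v = 0 → v ≠ 0 → 0 < g.val x v v) :
    g.IsLorentzian := by
  intro x
  obtain ⟨ξ, neg, pos⟩ := h x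
  exact ⟨g.sharp x ξ, by rwa [g.sharp_spec], fun w hw => pos w (by rwa [← g.sharp_spec])⟩

lemma splitsAlong_of_cometric_neg {τ : M → ℝ} (hτ : ContMDiff (𝓡 n) 𝓘(ℝ, ℝ) ∞ τ)
    (smooth : ContMDiff (𝓡 n) 𝓘(ℝ, ℝ) ∞
      fun x => g.cometric x (differential τ x) (differential τ x))
    (neg : ∀ x, g.cometric x (differential τ x) (differential τ x) < 0)
    (pos : ∀ x v, differential τ x v = 0 → v ≠ 0 → 0 < g.val x v v) : g.SplitsAlong τ := by
  set β : M → ℝ := fun x => -(g.cometric x (differential τ x) (differential τ x))⁻¹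
  have β_smooth : ContMDiff (𝓡 n) 𝓘(ℝ, ℝ) ∞ β := fun x =>
    ((contDiffAt_inv ℝ (neg x).ne).contMDiffAt.comp x (smooth x)).neg
  have β_mul (x) : β x * differential τ x (g.sharp x (differential τ x)) = -1 :=
    (neg_mul _ _).trans (congrArg Neg.neg (inv_mul_cancel₀ (neg x).ne))
  have smooth_tensor : IsSmoothTwoTensor fun x =>
      g.val x + β x • (differential τ x).smulRight (differential τ x) :=
    g.smooth.add_section (β_smooth.smul_section (isSmoothTwoTensor_differential_sq hτ))
  refine ⟨β, fun x => g.val x + β x • (differential τ x).smulRight (differential τ x), β_smooth,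
    fun x => neg_pos.2 (inv_lt_zero.2 (neg x)), smooth_tensor, fun x v w => ?_,
    fun x => ⟨fun v w => ?_, fun v hv hv0 => ?_, fun w => ?_, (neg x).ne⟩⟩
  · simp [g.symm x v w, mul_comm]
  · simp
  · simpa [hv] using pos x v hv hv0
  · simp only [add_apply, smul_apply, ContinuousLinearMap.smulRight_apply, g.sharp_spec,
      smul_eq_mul, ← mul_assoc, β_mul]
    ring

end PseudoRiemannianMetric

namespace IsTemporal

variable {g : PseudoRiemannianMetric n M} {S : SpinStructure g} {i : S.ι} {x : M}
  {ξ : TangentSpace (𝓡 n) x →L[ℝ] ℝ}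

lemma val_pos (h : IsTemporal (g.cometricForm x) (S.cliffordMap i x) ξ) (hx : x ∈ S.U i)
    {v : TangentSpace (𝓡 n) x} (hv : ξ v = 0) (hv0 : v ≠ 0) : 0 < g.val x v v := by
  have flat_ne_zero : g.val x v ≠ 0 := fun h0 => hv0 (g.nondegenerate x v (by simp [h0]))
  have pos := h.pos_of_orthogonal (A := SpinorSpace n →L[ℂ] SpinorSpace n)
    (S.isCliffordMap_cliffordMap hx) (g.separatingLeft_cometricForm x)
    ((g.cometric_val x ξ v).trans hv) flat_ne_zero
  rwa [g.cometricForm_apply, g.cometric_val] at pos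

lemma isSelfAdjoint_coordFun_and_cometric_eq_zero
    {e : OpenPartialHomeomorph M (EuclideanSpace ℝ (Fin n))}
    (he : e ∈ IsManifold.maximalAtlas (𝓡 n) ∞ M) {μ k : Fin n} (hμ : μ ≠ k)
    (h : IsTemporal (g.cometricForm x) (S.cliffordMap i x) (differential (coordFun e k) x))
    (hx : x ∈ e.source ∩ S.U i)
    (hstar : IsSelfAdjoint (S.c i x (differential (coordFun e μ) x)) ∨
      star (S.c i x (differential (coordFun e μ) x)) =
        -S.c i x (differential (coordFun e μ) x)) :
    IsSelfAdjoint (S.c i x (differential (coordFun e μ) x)) ∧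
      g.cometric x (differential (coordFun e k) x) (differential (coordFun e μ) x) = 0 := by
  have clifford := S.isCliffordMap_cliffordMap hx.2
  have isSelfAdjoint := hstar.resolve_right fun star_eq =>
    differential_coordFun_notMem_span he hx.1 hμ
      (h.mem_span_of_star_eq_neg clifford (g.separatingLeft_cometricForm x) star_eq)
  exact ⟨isSelfAdjoint, (h.isSelfAdjoint_iff clifford).1 isSelfAdjoint⟩

end IsTemporal

end Splitting

theorem mainTheorem1_general {n : ℕ} {M : Type*} [TopologicalSpace M]
    [ChartedSpace (EuclideanSpace ℝ (Fin n)) M] [IsManifold (𝓡 n) ∞ M]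
    [T2Space M] [MeasurableSpace M] [BorelSpace M] {g : PseudoRiemannianMetric n M}
    {S : SpinStructure g} {m : Measure M} [IsLocallyFiniteMeasure m] [m.IsOpenPosMeasure]
    {D : S.testSpinors → S.testSpinors} {τ : C^∞⟮𝓡 n, M; ℝ⟯} (hD : S.IsTemporalDirac m D τ) :
    (∀ x : M, g.cometric x (differential τ x) (differential τ x) < 0) ∧
    g.IsLorentzian ∧
    (∀ i, ∀ x ∈ S.U i,
      star (S.c i x (differential τ x)) = -S.c i x (differential τ x) ∧
      ∀ ξ, g.cometric x (differential τ x) ξ = 0 → IsSelfAdjoint (S.c i x ξ)) ∧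
    g.SplitsAlong τ ∧
    (∀ e ∈ IsManifold.maximalAtlas (𝓡 n) ∞ M, ∀ k : Fin n,
      (∀ y ∈ e.source, coordFun e k y = τ y) →
      ∀ i, ∀ x ∈ e.source ∩ S.U i,
        g.cometric x (differential (coordFun e k) x) (differential (coordFun e k) x) < 0 ∧
        ((∀ μ, IsSelfAdjoint (S.c i x (differential (coordFun e μ) x)) ∨
            star (S.c i x (differential (coordFun e μ) x)) =
              -S.c i x (differential (coordFun e μ) x)) →
          ∀ μ, μ ≠ k →
            IsSelfAdjoint (S.c i x (differential (coordFun e μ) x)) ∧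
            g.cometric x (differential (coordFun e k) x)
              (differential (coordFun e μ) x) = 0)) := by
  have val_pos (x) (v : TangentSpace (𝓡 n) x) (hv : differential τ x v = 0) (hv0 : v ≠ 0) :
      0 < g.val x v v := by
    obtain ⟨i, hx⟩ := S.cover x
    exact (hD.isTemporal hx).val_pos hx hv hv0
  refine ⟨hD.cometric_neg,
    PseudoRiemannianMetric.isLorentzian_of_forall_exists_covector fun x =>
      ⟨differential τ x, hD.cometric_neg x, val_pos x⟩,
    fun i x hx => ⟨hD.star_c_eq hx, fun ξ hξ =>
      ((hD.isTemporal hx).isSelfAdjoint_iff (S.isCliffordMap_cliffordMap hx)).2 hξ⟩,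
    PseudoRiemannianMetric.splitsAlong_of_cometric_neg τ.contMDiff
      (S.contMDiff_cometric_differential τ.contMDiff) hD.cometric_neg val_pos,
    fun e he k hk i x hx => ?_⟩
  have temporal := hD.isTemporal hx.2
  rw [← differential_coordFun_eq hk hx.1] at temporal
  exact ⟨temporal.neg, fun h μ hμ =>
    temporal.isSelfAdjoint_coordFun_and_cometric_eq_zero he hμ hx (h μ)⟩

theorem mainTheorem1 {n : ℕ} {M : Type*} [TopologicalSpace M]
    [ChartedSpace (EuclideanSpace ℝ (Fin n)) M] [IsManifold (𝓡 n) ∞ M]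
    [T2Space M] [SecondCountableTopology M] [MeasurableSpace M] [BorelSpace M]
    {H : Type*} [NormedAddCommGroup H] [InnerProductSpace ℂ H] [CompleteSpace H]
    (X : TemporalLorentzianSpectralTriple H) (hX : X.IsCommutative)
    (g : PseudoRiemannianMetric n M) (S : SpinStructure g) (time : M → ℝ)
    (hS : ComesFromSpinManifold X S time) :
    -- `dT` is timelike everywhere, and the geometry is Lorentzian
    (∀ x : M, g.cometric x (differential time x) (differential time x) < 0) ∧
    g.IsLorentzian ∧
    -- `c(dT)` is anti-Hermitian, `c(ξ)` is Hermitian for `ξ` orthogonal to `dT`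
    (∀ i, ∀ x ∈ S.U i,
      star (S.c i x (differential time x)) = -S.c i x (differential time x) ∧
      ∀ ξ, g.cometric x (differential time x) ξ = 0 → IsSelfAdjoint (S.c i x ξ)) ∧
    -- the metric splits globally
    g.SplitsAlong time ∧
    -- local coordinates with `x^0 = T` (the index called `0` in the comments is `k`)
    (∀ e ∈ IsManifold.maximalAtlas (𝓡 n) ∞ M, ∀ k : Fin n,
      (∀ y ∈ e.source, coordFun e k y = time y) →
      ∀ i, ∀ x ∈ e.source ∩ S.U i,
        -- `g^{00} < 0`
        g.cometric x (differential (coordFun e k) x) (differential (coordFun e k) x) < 0 ∧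
        -- if every `γ^μ` is Hermitian or anti-Hermitian, then `γ^μ` is Hermitian and
        -- `g^{0μ} = 0` for all `μ > 0`
        ((∀ μ, IsSelfAdjoint (S.c i x (differential (coordFun e μ) x)) ∨
            star (S.c i x (differential (coordFun e μ) x)) =
              -S.c i x (differential (coordFun e μ) x)) →
          ∀ μ, μ ≠ k →
            IsSelfAdjoint (S.c i x (differential (coordFun e μ) x)) ∧
            g.cometric x (differential (coordFun e k) x)
              (differential (coordFun e μ) x) = 0)) := by
  obtain ⟨D, hD⟩ := hS.exists_isTemporalDirac
  have := hS.isVolume.isLocallyFiniteMeasure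
  have := hS.isVolume.isOpenPosMeasure
  exact mainTheorem1_general hD
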